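/- Let $N$ be a free abelian group of rank $d$, $M=\mathrm{Hom}(N,\mathbb Z)$ the dual lattice, $N_{\mathbb R}=N\otimes\mathbb R$, $M_{\mathbb R}=M\otimes\mathbb R$, with the natural pairing $\langle\cdot,\cdot\rangle: M_{\mathbb R}\times N_{\mathbb R}\to\mathbb R$. Let $C\subset N_{\mathbb R}$ be a $d$-dimensional rational polyhedral cone (generated by finitely many elements of $N$) with vertex $0$, i.e. $C\cap(-C)=\{0\}$, let $C^\circ$ be its interior, and let $m\in M$ be a primitive lattice point such that $C(1):=\{y\in C:\langle m,y\rangle\le 1\}$ is compact. Then $\langle m,n\rangle$ is a non-negative integer for all $n\in C\cap N$, and each value is taken only finitely often on $C\cap N$, so that $$R(C,m,t)=\sum_{n\in C\cap N}t^{\langle m,n\rangle},\qquad R(C^\circ,m,t)=\sum_{n\in C^\circ\cap N}t^{\langle m,n\rangle}$$ are well-defined power series in $t$, and $R(C^\circ,-m,t)=\sum_{n\in C^\circ\cap N}t^{-\langle m,n\rangle}$ is a well-defined power series in $t^{-1}$. The series $R(C,m,t)$ and $R(C^\circ,m,t)$ are the expansions at $t=0$ of rational functions with rational coefficients, the series $R(C^\circ,-m,t)$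 is the expansion at $t=\infty$ of a rational function with rational coefficients, and, as rational functions, $$R(C,m,t)=(-1)^d\,R(C^\circ,-m,t).$$ Moreover, $$\lim_{t\to1}(1-t)^dR(C,m,t)=\lim_{t\to1}(t-1)^dR(C^\circ,-m,t)=v(C(1)),$$ where $v(C(1))=d!\,\mathrm{Vol}(C(1))$ and $\mathrm{Vol}$ is the Lebesgue measure on $N_{\mathbb R}$ normalized so that a fundamental parallelepiped of $N$ has volume $1$. -/

import Mathlib

open Filter Topology MeasureTheory

namespace LatticeCone

section Lattice

variable {E : Type*} [NormedAddCommGroup E] [NormedSpace ℝ E]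

/-- The dual lattice `M = Hom(N, ℤ)` of a full lattice `N ⊆ E = N_ℝ`, realized inside the real dual
space `M_ℝ` as the set of functionals that take integral values on `N`. -/
def dualLattice (N : Submodule ℤ E) : Submodule ℤ (Module.Dual ℝ E) where
  carrier := {f | ∀ n ∈ N, ∃ k : ℤ, f n = (k : ℝ)}
  zero_mem' := fun _ _ => ⟨0, by simp⟩
  add_mem' := by
    intro f g hf hg n hn
    obtain ⟨a, ha⟩ := hf n hn
    obtain ⟨b, hb⟩ := hg n hn
    exact ⟨a + b, by simp [ha, hb]⟩
  smul_mem' := by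
    intro c f hf n hn
    obtain ⟨a, ha⟩ := hf n hn
    exact ⟨c * a, by simp [ha]⟩

/-- `m` is a primitive point of the dual lattice: it lies in the dual lattice `M`, and it is not a
multiple `k • m'` of a point `m' ∈ M` with `k ≠ ±1` (the case `k = 0` says that `m ≠ 0`). -/
def IsPrimitive (N : Submodule ℤ E) (m : Module.Dual ℝ E) : Prop :=
  m ∈ dualLattice N ∧ ∀ (k : ℤ), ∀ m' ∈ dualLattice N, m = k • m' → IsUnit k

/-- A rational polyhedral cone: generated over `ℝ≥0` by finitely many lattice points. -/
def IsRationalPolyhedral (N : Submodule ℤ E) (C : PointedCone ℝ E) : Prop :=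
  ∃ S : Finset E, (S : Set E) ⊆ N ∧ C = PointedCone.hull ℝ (S : Set E)

/-- `C(1) = {y ∈ C : ⟨m, y⟩ ≤ 1}`. -/
def truncation (C : PointedCone ℝ E) (m : Module.Dual ℝ E) : Set E :=
  {y | y ∈ C ∧ m y ≤ 1}

/-- The lattice points `n ∈ A ∩ N` with `⟨m, n⟩ = k`. -/
def level (N : Submodule ℤ E) (A : Set E) (m : Module.Dual ℝ E) (k : ℤ) : Set E :=
  {n | n ∈ A ∧ n ∈ N ∧ m n = (k : ℝ)}

/-- The power series `∑_{n ∈ A ∩ N} t ^ ⟨m, n⟩` in `t`, for `m` with non-negative integral values and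
finite levels on `A ∩ N`. -/
noncomputable def series (N : Submodule ℤ E) (A : Set E) (m : Module.Dual ℝ E) : PowerSeries ℚ :=
  PowerSeries.mk fun k : ℕ => ((level N A m (k : ℤ)).ncard : ℚ)

/-- The series `∑_{n ∈ A ∩ N} t ^ ⟨m, n⟩` for `m` with non-positive integral values and finite levels
on `A ∩ N`; it is a power series in `s = t⁻¹`, whose coefficient at `s ^ k = t ^ (-k)` is the number
of `n ∈ A ∩ N` with `⟨m, n⟩ = -k`. -/
noncomputable def seriesInv (N : Submodule ℤ E) (A : Set E) (m : Module.Dual ℝ E) :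
    PowerSeries ℚ :=
  PowerSeries.mk fun k : ℕ => ((level N A m (-(k : ℤ))).ncard : ℚ)

/-- The integral (normalized) volume `v(K) = d! Vol(K)`, `d = dim E`, where `Vol` is the Lebesgue
measure for which a fundamental parallelepiped of `N` has volume `1` (the Haar measure `μ` is used
only to define it: the quotient does not depend on `μ`). -/
noncomputable def integralVolume [MeasurableSpace E] (N : Submodule ℤ E) (μ : Measure E)
    (K : Set E) : ℝ :=
  ((Module.finrank ℝ E).factorial : ℝ) * (μ.real K / ZLattice.covolume N μ)

end Lattice

/-- The rational function `F` has the power series expansion `f` at `t = 0`. -/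
def ExpandsAtZero (F : RatFunc ℚ) (f : PowerSeries ℚ) : Prop :=
  (F : LaurentSeries ℚ) = (f : LaurentSeries ℚ)

/-- The rational function `F(t)` has the expansion `f(t⁻¹)` at `t = ∞`, that is, `F(s⁻¹)` has the
power series expansion `f(s)` at `s = 0`. -/
def ExpandsAtInfinity (F : RatFunc ℚ) (f : PowerSeries ℚ) : Prop :=
  ExpandsAtZero (F.eval RatFunc.C (RatFunc.X⁻¹ : RatFunc ℚ)) f

/-- The value of a rational function at a real number (outside its finitely many poles). -/
noncomputable def value (F : RatFunc ℚ) (t : ℝ) : ℝ :=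
  F.eval (algebraMap ℚ ℝ) t

end LatticeCone

namespace LatticeCone

/-! Take a simplicial cone with lattice edges `b i` of heights `h i`, with some facets removed.
Cancelling translations by the edges shows that its series is `P / ∏ (1 - t ^ h i)`, where `P`
counts by height the lattice points of a half-open parallelepiped (`series_halfOpenSlab`). The
reflection `x ↦ ∑ b i - x` carries this parallelepiped to the one with the complementary facets
removed (`ncard_level_halfOpenSlab_compl`). Hence `t ↦ t⁻¹` turns the rational function into `(-1) ^
d` times that of the complementary half-open cone. At `t = 1`, `P` counts cosets of the edge lattice
in `N`, so `P(1) / ∏ h i` is the normalized volume of the simplicial cone below height `1`.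

For general `C`, a generic weight on the generators yields a regular triangulation, controlled on
generic points by linear programming duality (`exists_generic_triangulation`). Fix a generic `q` in
the interior of `C`. For all small `ε > 0` (depending on `x`), `x ∈ C` iff `x + ε q ∈ C`, and `x ∈
C°` iff `x - ε q ∈ C`; both shifted points are generic, so each lies in at most one simplicial cone.
Thus `C` and `C°` are disjoint unions of half-open simplicial cones (`halfOpen_decomposition`), and
`q` and `-q` remove complementary facets. Reciprocity therefore holds summand by summand, with no
inclusion-exclusion over faces. Volumes add up because non-generic points form a null set. -/

open PowerSeries in
theorem coeff_series {E : Type*} [NormedAddCommGroup E] [NormedSpace ℝ E] (N : Submodule ℤ E)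
    (A : Set E) (m : Module.Dual ℝ E) (k : ℕ) :
    coeff k (series N A m) = ((level N A m k).ncard : ℚ) := by
  simp [series]

/-! ### Generating series under translation and disjoint union -/

section Series

variable {E : Type*} [NormedAddCommGroup E] [NormedSpace ℝ E] {N : Submodule ℤ E}
  {A : Set E} {m : Module.Dual ℝ E}

theorem level_mono {A' : Set E} (h : A ⊆ A') (k : ℤ) : level N A m k ⊆ level N A' m k :=
  fun _ hx => ⟨h hx.1, hx.2⟩

/-- Removing from `A` its translate by a lattice vector `v` of height `h` multiplies the generating
series by `1 - t ^ h`. -/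
theorem series_diff_translate {v : E} (hv : v ∈ N) {h : ℕ} (hmv : m v = h)
    (hA : ∀ x ∈ A, v + x ∈ A) (hpos : ∀ x ∈ A, 0 ≤ m x) (hfin : ∀ k, (level N A m k).Finite) :
    series N (A \ (v + ·) '' A) m = series N A m * (1 - PowerSeries.X ^ h) := by
  ext k
  have hlev : level N (A \ (v + ·) '' A) m k
      = level N A m k \ (v + ·) '' level N A m ((k : ℤ) - h) := by
    ext x
    constructor
    · rintro ⟨⟨hx, hx'⟩, hN, hk⟩
      refine ⟨⟨hx, hN, hk⟩, ?_⟩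
      rintro ⟨y, hy, rfl⟩
      exact hx' ⟨y, hy.1, rfl⟩
    · rintro ⟨⟨hx, hN, hk⟩, hx'⟩
      refine ⟨⟨hx, ?_⟩, hN, hk⟩
      rintro ⟨y, hy, rfl⟩
      refine hx' ⟨y, ⟨hy, by simpa using N.sub_mem hN hv, ?_⟩, rfl⟩
      simp only [map_add, hmv] at hk
      push_cast at hk ⊢
      linarith
  have hsub : (v + ·) '' level N A m ((k : ℤ) - h) ⊆ level N A m k := by
    rintro _ ⟨y, hy, rfl⟩
    refine ⟨hA y hy.1, N.add_mem hv hy.2.1, ?_⟩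
    have := hy.2.2
    push_cast at this
    simp only [map_add, hmv, this]
    push_cast
    ring
  rw [mul_sub, mul_one, map_sub, PowerSeries.coeff_mul_X_pow', coeff_series, coeff_series, hlev,
    Set.ncard_sdiff hsub ((hfin k).subset hsub),
    Nat.cast_sub (Set.ncard_le_ncard hsub (hfin k)),
    Set.ncard_image_of_injective _ (add_right_injective v)]
  congr 1
  -- For `k < h` the subtracted level has negative height, hence is empty.
  split_ifs with hk
  · rw [coeff_series, Nat.cast_sub hk]
  · have : level N A m ((k : ℤ) - h) = ∅ := by
      rw [Set.eq_empty_iff_forall_notMem]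
      rintro x ⟨hx, -, hxk⟩
      have h1 := hpos x hx
      have h2 : (k : ℝ) < h := by exact_mod_cast not_le.mp hk
      push_cast at hxk
      linarith
    rw [this, Set.ncard_empty, Nat.cast_zero]

theorem ncard_level_eq_sum {β : Type*} (T : Finset β) (K : β → Set E)
    (hmem : ∀ x, x ∈ A ↔ ∃ B ∈ T, x ∈ K B)
    (huniq : ∀ x, ∀ B ∈ T, ∀ B' ∈ T, x ∈ K B → x ∈ K B' → B = B') (k : ℤ)
    (hfin : (level N A m k).Finite) :
    (level N A m k).ncard = ∑ B ∈ T, (level N (K B) m k).ncard := by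
  classical
  have hsub : ∀ B ∈ T, level N (K B) m k ⊆ level N A m k := fun B hB =>
    level_mono (fun x hx => (hmem x).2 ⟨B, hB, hx⟩) k
  have h1 : level N A m k = ⋃ B ∈ T, level N (K B) m k := by
    ext x
    simp only [Set.mem_iUnion]
    constructor
    · rintro ⟨hx, hN, hk⟩
      obtain ⟨B, hB, hxB⟩ := (hmem x).1 hx
      exact ⟨B, hB, hxB, hN, hk⟩
    · rintro ⟨B, hB, hx⟩
      exact hsub B hB hx
  have h2 := T.finite_toSet.ncard_biUnion (s := fun B => level N (K B) m k)
    (fun B hB => hfin.subset (hsub B hB)) ?_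
  · rw [finsum_mem_coe_finset] at h2
    rw [h1, ← h2]
    simp
  intro B hB B' hB' hne
  exact Set.disjoint_left.2 fun x hx hx' => hne (huniq x B hB B' hB' hx.1 hx'.1)

theorem series_eq_sum {β : Type*} (T : Finset β) (K : β → Set E)
    (hmem : ∀ x, x ∈ A ↔ ∃ B ∈ T, x ∈ K B)
    (huniq : ∀ x, ∀ B ∈ T, ∀ B' ∈ T, x ∈ K B → x ∈ K B' → B = B')
    (hfin : ∀ k, (level N A m k).Finite) :
    series N A m = ∑ B ∈ T, series N (K B) m := by
  ext k
  rw [map_sum]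
  simp only [coeff_series]
  rw [ncard_level_eq_sum T K hmem huniq k (hfin k)]
  push_cast
  rfl

end Series

/-! ### Expansion and evaluation of rational functions -/

section RatFunc

open Polynomial

theorem expandsAtZero_sum {β : Type*} (T : Finset β) (F : β → RatFunc ℚ) (f : β → PowerSeries ℚ)
    (h : ∀ B ∈ T, ExpandsAtZero (F B) (f B)) :
    ExpandsAtZero (∑ B ∈ T, F B) (∑ B ∈ T, f B) := by
  unfold ExpandsAtZero at *
  rw [map_sum, map_sum]
  exact Finset.sum_congr rfl h

theorem coe_div_eq_of_mul_eq {K : Type*} [Field K] {P Q : K[X]} (hQ : Q ≠ 0) {f : PowerSeries K}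
    (h : f * (Q : PowerSeries K) = P) :
    ((algebraMap K[X] (RatFunc K) P / algebraMap K[X] (RatFunc K) Q : RatFunc K) :
      LaurentSeries K) = (f : LaurentSeries K) := by
  have e : ∀ R : K[X], ((algebraMap K[X] (RatFunc K) R : RatFunc K) : LaurentSeries K)
      = ((R : PowerSeries K) : LaurentSeries K) := fun R => by
    rw [RatFunc.coe_coe, RatFunc.coePolynomial_eq_algebraMap]
  have hQ' : ((algebraMap K[X] (RatFunc K) Q : RatFunc K) : LaurentSeries K) ≠ 0 := by
    simpa using hQ
  rw [map_div₀, div_eq_iff hQ', e, e, ← h, PowerSeries.coe_mul]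

theorem expandsAtZero_div {P Q : ℚ[X]} (hQ : Q ≠ 0) {f : PowerSeries ℚ}
    (h : f * (Q : PowerSeries ℚ) = P) :
    ExpandsAtZero (algebraMap ℚ[X] (RatFunc ℚ) P / algebraMap ℚ[X] (RatFunc ℚ) Q) f :=
  coe_div_eq_of_mul_eq hQ h

/-- `RatFunc.eval` uses the reduced fraction, whose denominator divides `Q`. Its non-vanishing is
kept as a second conclusion because additivity and multiplicativity of `RatFunc.eval` require it. -/
theorem eval_algebraMap_div {L : Type} [Field L] (f : ℚ →+* L) (a : L) {P Q : ℚ[X]}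
    (hQ : Q.eval₂ f a ≠ 0) :
    (algebraMap ℚ[X] (RatFunc ℚ) P / algebraMap ℚ[X] (RatFunc ℚ) Q).eval f a
      = P.eval₂ f a / Q.eval₂ f a ∧
    (algebraMap ℚ[X] (RatFunc ℚ) P / algebraMap ℚ[X] (RatFunc ℚ) Q).denom.eval₂ f a ≠ 0 := by
  have hQ0 : Q ≠ 0 := by rintro rfl; simp at hQ
  have hd : (algebraMap ℚ[X] (RatFunc ℚ) P / algebraMap ℚ[X] (RatFunc ℚ) Q).denom.eval₂ f a ≠ 0 :=
    fun h => hQ (eval₂_eq_zero_of_dvd_of_eval₂_eq_zero f a (RatFunc.denom_div_dvd P Q) h)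
  refine ⟨?_, hd⟩
  rw [RatFunc.eval, div_eq_div_iff hd hQ, ← eval₂_mul, ← eval₂_mul,
    (RatFunc.num_mul_eq_mul_denom_iff hQ0).2 rfl]

theorem eval_sum {L : Type} [Field L] (f : ℚ →+* L) (a : L) {β : Type*} (T : Finset β)
    (F : β → RatFunc ℚ) (h : ∀ B ∈ T, (F B).denom.eval₂ f a ≠ 0) :
    (∑ B ∈ T, F B).eval f a = ∑ B ∈ T, (F B).eval f a ∧
      (∑ B ∈ T, F B).denom.eval₂ f a ≠ 0 := by
  classical
  induction T using Finset.induction_on with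
  | empty => simp
  | insert B T hB ih =>
    obtain ⟨h1, h2⟩ := ih fun B' hB' => h B' (Finset.mem_insert_of_mem hB')
    have h3 := h B (Finset.mem_insert_self B T)
    rw [Finset.sum_insert hB, Finset.sum_insert hB, RatFunc.eval_add _ _ h3 h2, h1]
    refine ⟨rfl, fun h0 => ?_⟩
    have := eval₂_eq_zero_of_dvd_of_eval₂_eq_zero f a (RatFunc.denom_add_dvd _ _) h0
    rw [eval₂_mul] at this
    exact (mul_ne_zero h3 h2) this

theorem eval_C_mul {L : Type} [Field L] (f : ℚ →+* L) (a : L) (c : ℚ) (F : RatFunc ℚ)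
    (h : F.denom.eval₂ f a ≠ 0) : (RatFunc.C c * F).eval f a = f c * F.eval f a := by
  rw [RatFunc.eval_mul _ _ (by rw [RatFunc.denom_C]; simp) h, RatFunc.eval_C]

/-- Since `X⁻¹` is transcendental, the substitution `t ↦ t⁻¹` never meets a pole. -/
theorem eval₂_C_inv_X_ne_zero {K : Type*} [Field K] {Q : K[X]} (hQ : Q ≠ 0) :
    Q.eval₂ (RatFunc.C : K →+* RatFunc K) RatFunc.X⁻¹ ≠ 0 := by
  have h : Transcendental K (RatFunc.X⁻¹ : RatFunc K) := fun h =>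
    RatFunc.transcendental_X (K := K) (by simpa using h.inv)
  have := (transcendental_iff.1 h) Q
  rw [aeval_def, RatFunc.algebraMap_eq_C] at this
  exact fun h0 => hQ (this h0)

end RatFunc

/-! ### The substitution of the inverse variable -/

section Reciprocity

open Polynomial

/-- The denominator `∏ (1 - t ^ h i)` of the generating function of a simplicial cone. -/
noncomputable def cyclicDenom {ι : Type*} [Fintype ι] (h : ι → ℕ) : ℚ[X] :=
  ∏ i, (1 - X ^ h i)

variable {ι : Type*} [Fintype ι] {h : ι → ℕ}

theorem cyclicDenom_ne_zero (hpos : ∀ i, 0 < h i) : cyclicDenom h ≠ 0 := by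
  refine Finset.prod_ne_zero_iff.2 fun i _ h0 => ?_
  have := congrArg (eval 0) h0
  simp [(hpos i).ne'] at this

theorem eval₂_cyclicDenom {L : Type*} [CommRing L] (f : ℚ →+* L) (a : L) :
    (cyclicDenom h).eval₂ f a = ∏ i, (1 - a ^ h i) := by
  simp [cyclicDenom, eval₂_finsetProd]

theorem coe_cyclicDenom :
    ((cyclicDenom h : ℚ[X]) : PowerSeries ℚ) = ∏ i, (1 - PowerSeries.X ^ h i) := by
  rw [cyclicDenom, ← Polynomial.coeToPowerSeries.ringHom_apply, map_prod]
  simp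

theorem algebraMap_eq_eval₂_X {K : Type*} [Field K] (Q : K[X]) :
    algebraMap K[X] (RatFunc K) Q = Q.eval₂ RatFunc.C RatFunc.X := by
  rw [← RatFunc.aeval_X_left_eq_algebraMap, aeval_def, RatFunc.algebraMap_eq_C]

/-- Each factor satisfies `1 - t ^ h = -t ^ h (1 - t ^ (-h))`, which produces the sign and the power
`t ^ ∑ h i`; the latter is absorbed by reversing the coefficients of `P`. -/
theorem eval_inv_X_div_cyclicDenom (hpos : ∀ i, 0 < h i) (P : ℚ[X])
    (hP : P.natDegree ≤ ∑ i, h i) :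
    (algebraMap ℚ[X] (RatFunc ℚ) P / algebraMap ℚ[X] (RatFunc ℚ) (cyclicDenom h)).eval
        RatFunc.C (RatFunc.X⁻¹ : RatFunc ℚ) =
      (-1) ^ Fintype.card ι * (algebraMap ℚ[X] (RatFunc ℚ) (P.reflect (∑ i, h i)) /
        algebraMap ℚ[X] (RatFunc ℚ) (cyclicDenom h)) := by
  have hD := cyclicDenom_ne_zero hpos
  have hX : (RatFunc.X : RatFunc ℚ) ≠ 0 := RatFunc.X_ne_zero
  have hev := eval₂_C_inv_X_ne_zero hD
  rw [(eval_algebraMap_div RatFunc.C RatFunc.X⁻¹ hev).1]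
  have e (Q : ℚ[X]) : algebraMap ℚ[X] (RatFunc ℚ) Q = Q.eval₂ RatFunc.C RatFunc.X :=
    algebraMap_eq_eval₂_X Q
  have h1 : (P.reflect (∑ i, h i)).eval₂ RatFunc.C RatFunc.X
      = P.eval₂ RatFunc.C RatFunc.X⁻¹ * (RatFunc.X : RatFunc ℚ) ^ (∑ i, h i) := by
    have : Invertible (RatFunc.X⁻¹ : RatFunc ℚ) := invertibleOfNonzero (inv_ne_zero hX)
    have := eval₂_reflect_mul_pow (RatFunc.C : ℚ →+* RatFunc ℚ) (RatFunc.X⁻¹ : RatFunc ℚ)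
      (∑ i, h i) P hP
    rw [← this, invOf_eq_inv, inv_inv, mul_assoc, ← mul_pow, inv_mul_cancel₀ hX, one_pow, mul_one]
  have h2 : (cyclicDenom h).eval₂ RatFunc.C RatFunc.X
      = (-1) ^ Fintype.card ι * (cyclicDenom h).eval₂ RatFunc.C RatFunc.X⁻¹ *
        (RatFunc.X : RatFunc ℚ) ^ (∑ i, h i) := by
    rw [eval₂_cyclicDenom, eval₂_cyclicDenom, ← Finset.prod_pow_eq_pow_sum, ← Finset.card_univ,
      ← Finset.prod_const, ← Finset.prod_mul_distrib, ← Finset.prod_mul_distrib]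
    refine Finset.prod_congr rfl fun i _ => ?_
    have : (RatFunc.X : RatFunc ℚ) ^ h i ≠ 0 := pow_ne_zero _ hX
    rw [inv_pow]
    field_simp
    ring
  rw [e, e, h1, h2]
  have h3 : ((-1 : RatFunc ℚ) ^ Fintype.card ι) ≠ 0 := pow_ne_zero _ (by simp)
  have h4 : (RatFunc.X : RatFunc ℚ) ^ (∑ i, h i) ≠ 0 := pow_ne_zero _ hX
  field_simp

end Reciprocity

/-! ### Half-open simplicial cones and parallelepipeds -/

section HalfOpen

variable {E : Type*} [NormedAddCommGroup E] [NormedSpace ℝ E] {ι : Type*}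

/-- The simplicial cone spanned by a basis `b`, with the facets opposite to the `b i`, `i ∉ J`,
removed. -/
def halfOpenCone (b : Module.Basis ι ℝ E) (J : Set ι) : Set E :=
  {x | ∀ i, (i ∈ J → 0 ≤ b.repr x i) ∧ (i ∉ J → 0 < b.repr x i)}

/-- The points of the half-open cone that are reduced modulo `b i` for all `i ∈ I`. -/
def halfOpenSlab (b : Module.Basis ι ℝ E) (J : Set ι) (I : Set ι) : Set E :=
  {x | x ∈ halfOpenCone b J ∧ ∀ i ∈ I, (i ∈ J → b.repr x i < 1) ∧ (i ∉ J → b.repr x i ≤ 1)}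

variable {b : Module.Basis ι ℝ E} {J : Set ι}

theorem halfOpenCone_coord_nonneg {x : E} (hx : x ∈ halfOpenCone b J) (i : ι) :
    0 ≤ b.repr x i := by
  by_cases hi : i ∈ J
  · exact (hx i).1 hi
  · exact ((hx i).2 hi).le

/-- The bound on the `j`-th coordinate fails exactly when `b j` can be subtracted without leaving
the cone; this affects no other coordinate. -/
theorem halfOpenSlab_insert (I : Set ι) {j : ι} (hj : j ∉ I) :
    halfOpenSlab b J (insert j I) = halfOpenSlab b J I \ (b j + ·) '' halfOpenSlab b J I := by
  classical
  ext x
  have hcoord (y : E) (i : ι) : b.repr (b j + y) i = (if j = i then 1 else 0) + b.repr y i := by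
    rw [map_add, Finsupp.add_apply, b.repr_self, Finsupp.single_apply]
  constructor
  · rintro ⟨hx, hI⟩
    refine ⟨⟨hx, fun i hi => hI i (Set.mem_insert_of_mem _ hi)⟩, ?_⟩
    rintro ⟨y, ⟨hy, -⟩, rfl⟩
    have h1 := hI j (Set.mem_insert _ _)
    have h2 := hy j
    simp only [hcoord, if_true] at h1
    by_cases hJ : j ∈ J
    · linarith [h1.1 hJ, h2.1 hJ]
    · linarith [h1.2 hJ, h2.2 hJ]
  · rintro ⟨⟨hx, hI⟩, hx'⟩
    refine ⟨hx, ?_⟩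
    rintro i (rfl | hi)
    · by_contra hcon
      refine hx' ⟨x - b i, ⟨fun k => ?_, fun k hk => ?_⟩, by simp⟩
      · have h3 := hx k
        have h4 := hcoord (x - b i) k
        rw [add_sub_cancel] at h4
        by_cases hki : i = k
        · subst hki
          rw [if_pos rfl] at h4
          refine ⟨fun hJ => ?_, fun hJ => ?_⟩
          · by_contra hneg
            exact hcon ⟨fun _ => by linarith, fun h => absurd hJ h⟩
          · by_contra hneg
            exact hcon ⟨fun h => absurd h hJ, fun _ => by linarith⟩
        · rw [if_neg hki, zero_add] at h4
          rwa [← h4]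
      · have h4 := hcoord (x - b i) k
        rw [add_sub_cancel, if_neg (by rintro rfl; exact hj hk), zero_add] at h4
        rw [← h4]
        exact hI k hk
    · exact hI i hi

theorem add_mem_halfOpenSlab {I : Set ι} {j : ι} (hj : j ∉ I) {x : E}
    (hx : x ∈ halfOpenSlab b J I) : b j + x ∈ halfOpenSlab b J I := by
  classical
  have hcoord (i : ι) : b.repr (b j + x) i = (if j = i then 1 else 0) + b.repr x i := by
    rw [map_add, Finsupp.add_apply, b.repr_self, Finsupp.single_apply]
  refine ⟨fun i => ?_, fun i hi => ?_⟩
  · have := hx.1 i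
    rw [hcoord]
    split_ifs
    · exact ⟨fun h => by linarith [this.1 h], fun h => by linarith [this.2 h]⟩
    · rwa [zero_add]
  · rw [hcoord, if_neg (by rintro rfl; exact hj hi), zero_add]
    exact hx.2 i hi

variable [Fintype ι] {N : Submodule ℤ E} {m : Module.Dual ℝ E} {h : ι → ℕ}

theorem height_eq_sum (hm : ∀ i, m (b i) = h i) (x : E) : m x = ∑ i, b.repr x i * h i := by
  conv_lhs => rw [← b.sum_repr x]
  rw [map_sum]
  exact Finset.sum_congr rfl fun i _ => by rw [map_smul, hm, smul_eq_mul]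

/-- The generating series of the half-open parallelepiped. -/
theorem series_halfOpenSlab (hb : ∀ i, b i ∈ N) (hm : ∀ i, m (b i) = h i)
    (hfin : ∀ k, (level N (halfOpenCone b J) m k).Finite) :
    series N (halfOpenCone b J) m * (cyclicDenom h : PowerSeries ℚ)
      = series N (halfOpenSlab b J Set.univ) m := by
  classical
  have key : ∀ I : Finset ι, series N (halfOpenSlab b J (I : Set ι)) m
      = series N (halfOpenCone b J) m * ∏ i ∈ I, (1 - PowerSeries.X ^ h i) := by
    intro I
    induction I using Finset.induction_on with
    | empty =>
      rw [Finset.prod_empty, mul_one]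
      congr 1
      ext x
      simp [halfOpenSlab]
    | insert j I hj ih =>
      have hj' : j ∉ (I : Set ι) := by simpa using hj
      rw [Finset.coe_insert, halfOpenSlab_insert _ hj',
        series_diff_translate (hb j) (hm j) (fun x hx => add_mem_halfOpenSlab hj' hx) ?_ ?_, ih,
        Finset.prod_insert hj, mul_assoc, mul_comm (1 - _)]
      · intro x hx
        rw [height_eq_sum hm]
        exact Finset.sum_nonneg fun i _ =>
          mul_nonneg (halfOpenCone_coord_nonneg hx.1 i) (Nat.cast_nonneg _)
      · exact fun k => (hfin k).subset (level_mono (fun x hx => hx.1) k)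
  rw [coe_cyclicDenom, ← Finset.coe_univ, key]

/-- The point reflection `x ↦ ∑ b i - x` exchanges the two complementary half-open
parallelepipeds. -/
theorem ncard_level_halfOpenSlab_compl (hb : ∀ i, b i ∈ N) (hm : ∀ i, m (b i) = h i) (k : ℤ) :
    (level N (halfOpenSlab b Jᶜ Set.univ) m k).ncard
      = (level N (halfOpenSlab b J Set.univ) m ((∑ i, h i : ℕ) - k)).ncard := by
  classical
  set s : E := ∑ i, b i with hs
  have hsN : s ∈ N := N.sum_mem fun i _ => hb i
  have hms : m s = (∑ i, h i : ℕ) := by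
    rw [hs, map_sum]
    push_cast
    exact Finset.sum_congr rfl fun i _ => hm i
  have hcoord (x : E) (i : ι) : b.repr (s - x) i = 1 - b.repr x i := by
    rw [map_sub, Finsupp.sub_apply, hs, map_sum, Finsupp.finsetSum_apply]
    simp [Finsupp.single_apply]
  -- In each coordinate `x ↦ 1 - x` exchanges `[0, 1)` and `(0, 1]`.
  have hrefl : ∀ (J : Set ι) (x : E), x ∈ halfOpenSlab b J Set.univ →
      s - x ∈ halfOpenSlab b Jᶜ Set.univ := by
    intro J x hx
    refine ⟨fun i => ?_, fun i _ => ?_⟩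
    all_goals
      have h1 := hx.1 i
      have h2 := hx.2 i (Set.mem_univ i)
      rw [hcoord]
      refine ⟨fun hi => ?_, fun hi => ?_⟩
    · linarith [h2.2 hi]
    · linarith [h2.1 (not_not.1 hi)]
    · linarith [h1.2 hi]
    · linarith [h1.1 (not_not.1 hi)]
  have himg : level N (halfOpenSlab b J Set.univ) m ((∑ i, h i : ℕ) - k)
      = (s - ·) '' level N (halfOpenSlab b Jᶜ Set.univ) m k := by
    ext x
    constructor
    · rintro ⟨hx, hN, hk⟩
      refine ⟨s - x, ⟨hrefl J x hx, N.sub_mem hsN hN, ?_⟩, by simp⟩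
      rw [map_sub, hms, hk]
      push_cast
      ring
    · rintro ⟨y, ⟨hy, hN, hk⟩, rfl⟩
      refine ⟨by simpa using hrefl _ _ hy, N.sub_mem hsN hN, ?_⟩
      rw [map_sub, hms, hk]
      push_cast
      ring
  rw [himg, Set.ncard_image_of_injective _ sub_right_injective]

open Polynomial in
/-- The numerator of the generating function of a half-open simplicial cone. -/
noncomputable def slabPolynomial (N : Submodule ℤ E) (b : Module.Basis ι ℝ E) (J : Set ι)
    (m : Module.Dual ℝ E) (h : ι → ℕ) : ℚ[X] :=
  ∑ k ∈ Finset.range (∑ i, h i + 1),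
    monomial k ((level N (halfOpenSlab b J Set.univ) m (k : ℤ)).ncard : ℚ)

theorem coeff_slabPolynomial (hm : ∀ i, m (b i) = h i) (k : ℕ) :
    (slabPolynomial N b J m h).coeff k
      = ((level N (halfOpenSlab b J Set.univ) m (k : ℤ)).ncard : ℚ) := by
  simp only [slabPolynomial, Polynomial.finsetSum_coeff, Polynomial.coeff_monomial,
    Finset.sum_ite_eq', Finset.mem_range]
  split_ifs with hk
  · rfl
  · have : level N (halfOpenSlab b J Set.univ) m (k : ℤ) = ∅ := by
      rw [Set.eq_empty_iff_forall_notMem]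
      rintro x ⟨hx, -, hxk⟩
      have h1 : m x ≤ (∑ i, h i : ℕ) := by
        rw [height_eq_sum hm]
        push_cast
        refine Finset.sum_le_sum fun i _ => ?_
        have h2 : b.repr x i ≤ 1 := by
          by_cases hi : i ∈ J
          · exact ((hx.2 i (Set.mem_univ i)).1 hi).le
          · exact (hx.2 i (Set.mem_univ i)).2 hi
        exact mul_le_of_le_one_left (Nat.cast_nonneg _) h2
      rw [hxk] at h1
      have : k ≤ ∑ i, h i := by exact_mod_cast h1
      omega
    rw [this, Set.ncard_empty, Nat.cast_zero]

theorem coe_slabPolynomial (hm : ∀ i, m (b i) = h i) :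
    ((slabPolynomial N b J m h : Polynomial ℚ) : PowerSeries ℚ)
      = series N (halfOpenSlab b J Set.univ) m := by
  ext k
  rw [Polynomial.coeff_coe, coeff_slabPolynomial hm, coeff_series]

theorem natDegree_slabPolynomial_le : (slabPolynomial N b J m h).natDegree ≤ ∑ i, h i := by
  refine Polynomial.natDegree_sum_le_of_forall_le _ _ fun k hk => ?_
  exact (Polynomial.natDegree_monomial_le _).trans (Nat.lt_succ_iff.1 (Finset.mem_range.1 hk))

theorem reflect_slabPolynomial (hb : ∀ i, b i ∈ N) (hm : ∀ i, m (b i) = h i) :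
    (slabPolynomial N b J m h).reflect (∑ i, h i) = slabPolynomial N b Jᶜ m h := by
  ext k
  rw [Polynomial.coeff_reflect]
  by_cases hk : k ≤ ∑ i, h i
  · rw [Polynomial.revAt_le hk, coeff_slabPolynomial hm, coeff_slabPolynomial hm,
      ncard_level_halfOpenSlab_compl hb hm, Nat.cast_sub hk]
  · rw [Polynomial.revAt_eq_self_of_lt (not_le.1 hk),
      Polynomial.coeff_eq_zero_of_natDegree_lt
        (natDegree_slabPolynomial_le.trans_lt (not_le.1 hk)),
      Polynomial.coeff_eq_zero_of_natDegree_lt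
        (natDegree_slabPolynomial_le.trans_lt (not_le.1 hk))]

/-- The generating function of the half-open simplicial cone, as a rational function. -/
noncomputable def coneFunction (N : Submodule ℤ E) (b : Module.Basis ι ℝ E) (J : Set ι)
    (m : Module.Dual ℝ E) (h : ι → ℕ) : RatFunc ℚ :=
  algebraMap (Polynomial ℚ) (RatFunc ℚ) (slabPolynomial N b J m h) /
    algebraMap (Polynomial ℚ) (RatFunc ℚ) (cyclicDenom h)

theorem expandsAtZero_coneFunction (hb : ∀ i, b i ∈ N) (hm : ∀ i, m (b i) = h i)
    (hpos : ∀ i, 0 < h i) (hfin : ∀ k, (level N (halfOpenCone b J) m k).Finite) :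
    ExpandsAtZero (coneFunction N b J m h) (series N (halfOpenCone b J) m) :=
  expandsAtZero_div (cyclicDenom_ne_zero hpos)
    (by rw [series_halfOpenSlab hb hm hfin, coe_slabPolynomial hm])

theorem eval_inv_X_coneFunction (hb : ∀ i, b i ∈ N) (hm : ∀ i, m (b i) = h i)
    (hpos : ∀ i, 0 < h i) :
    (coneFunction N b J m h).eval RatFunc.C (RatFunc.X⁻¹ : RatFunc ℚ) =
      (-1) ^ Fintype.card ι * coneFunction N b Jᶜ m h := by
  rw [coneFunction, eval_inv_X_div_cyclicDenom hpos _ natDegree_slabPolynomial_le,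
    reflect_slabPolynomial hb hm, coneFunction]

end HalfOpen

/-! ### Volume of weighted simplices -/

section Simplex

/-- Used coordinatewise to pass from the `ℓ¹` ball, of known volume, to its part in the positive
orthant. -/
theorem volume_map_abs :
    Measure.map (fun x : ℝ => |x|) volume = (2 : ENNReal) • volume.restrict (Set.Ici (0 : ℝ)) := by
  ext s hs
  rw [Measure.map_apply measurable_abs hs, Measure.smul_apply, Measure.restrict_apply hs,
    smul_eq_mul, two_mul]
  have h1 : (fun x : ℝ => |x|) ⁻¹' s = (s ∩ Set.Ici 0) ∪ Neg.neg ⁻¹' (s ∩ Set.Ioi 0) := by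
    ext x
    rcases le_or_gt 0 x with hx | hx
    · simp [abs_of_nonneg hx, hx, not_lt.2 hx]
    · simp [abs_of_neg hx, hx, not_le.2 hx]
  rw [h1, measure_union _ (measurable_neg (hs.inter measurableSet_Ioi)),
    Measure.measure_preimage_neg]
  · congr 1
    exact measure_congr (Filter.EventuallyEq.rfl.inter Ioi_ae_eq_Ici)
  · rw [Set.disjoint_left]
    rintro x ⟨-, hx⟩ ⟨-, hx'⟩
    simp only [Set.mem_Ici, Set.mem_Ioi] at hx hx'
    linarith

variable {ι : Type*} [Fintype ι]

theorem volume_map_abs_pi :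
    Measure.map (fun (x : ι → ℝ) i => |x i|) volume
      = (2 : ENNReal) ^ Fintype.card ι • volume.restrict (Set.univ.pi fun _ => Set.Ici (0 : ℝ)) := by
  have hσ : SigmaFinite ((2 : ENNReal) • volume.restrict (Set.Ici (0 : ℝ))) := by
    have : (2 : ENNReal) • volume.restrict (Set.Ici (0 : ℝ))
      = (2 : NNReal) • volume.restrict (Set.Ici (0 : ℝ)) := rfl
    rw [this]
    infer_instance
  have hσ' : SigmaFinite (Measure.map (fun x : ℝ => |x|) volume) := by
    rw [volume_map_abs]; exact hσ
  rw [volume_pi, Measure.pi_map_pi (fun _ => measurable_abs.aemeasurable)]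
  simp only [volume_map_abs]
  refine Measure.pi_eq fun s hs => ?_
  rw [Measure.smul_apply, Measure.restrict_pi_pi, Measure.pi_pi]
  simp only [Measure.smul_apply, smul_eq_mul]
  rw [Finset.prod_mul_distrib, Finset.prod_const, Finset.card_univ]

/-- The volume of the corner simplex. -/
theorem volume_corner_simplex [Nonempty ι] :
    volume {x : ι → ℝ | (∀ i, 0 ≤ x i) ∧ ∑ i, x i ≤ 1}
      = ENNReal.ofReal (1 / (Fintype.card ι).factorial) := by
  -- For exponent `1` and radius `1`, the Gamma factors reduce to `2 ^ d / d!`.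
  have h1 := volume_sum_rpow_le ι (le_refl (1 : ℝ)) 1
  simp only [Real.rpow_one, div_one, ENNReal.ofReal_one, one_pow, one_mul, one_add_one_eq_two,
    Real.Gamma_two, mul_one, Real.Gamma_nat_eq_factorial] at h1
  have hmeas : MeasurableSet {x : ι → ℝ | ∑ i, x i ≤ 1} :=
    measurableSet_le (Finset.measurable_sum _ fun i _ => measurable_pi_apply i) measurable_const
  have h2 : volume {x : ι → ℝ | ∑ i, |x i| ≤ 1}
      = Measure.map (fun (x : ι → ℝ) i => |x i|) volume {x : ι → ℝ | ∑ i, x i ≤ 1} := by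
    rw [Measure.map_apply (measurable_pi_lambda _ fun i => (measurable_pi_apply i).abs) hmeas]
    rfl
  rw [h2, volume_map_abs_pi, Measure.smul_apply, Measure.restrict_apply hmeas, smul_eq_mul] at h1
  have h3 : {x : ι → ℝ | (∀ i, 0 ≤ x i) ∧ ∑ i, x i ≤ 1}
      = {x : ι → ℝ | ∑ i, x i ≤ 1} ∩ Set.univ.pi fun _ => Set.Ici (0 : ℝ) := by
    ext x
    simp [and_comm, Pi.le_def]
  rw [h3]
  have h4 : ENNReal.ofReal (2 ^ Fintype.card ι / (Fintype.card ι).factorial)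
      = 2 ^ Fintype.card ι * ENNReal.ofReal (1 / (Fintype.card ι).factorial) := by
    rw [div_eq_mul_one_div, ENNReal.ofReal_mul (by positivity), ENNReal.ofReal_pow (by norm_num)]
    simp
  rw [h4] at h1
  exact (ENNReal.mul_right_inj (by simp) (by simp)).1 h1

theorem volume_weighted_simplex [Nonempty ι] {h : ι → ℝ} (hpos : ∀ i, 0 < h i) :
    volume {x : ι → ℝ | (∀ i, 0 ≤ x i) ∧ ∑ i, x i * h i ≤ 1}
      = ENNReal.ofReal (1 / ((Fintype.card ι).factorial * ∏ i, h i)) := by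
  classical
  have hprod : 0 < ∏ i, h i := Finset.prod_pos fun i _ => hpos i
  have hdet : LinearMap.det (Matrix.toLin' (Matrix.diagonal h)) = ∏ i, h i := by
    rw [LinearMap.det_toLin', Matrix.det_diagonal]
  have h1 := Measure.addHaar_preimage_linearMap volume
    (f := Matrix.toLin' (Matrix.diagonal h)) (by rw [hdet]; exact hprod.ne')
    {x : ι → ℝ | (∀ i, 0 ≤ x i) ∧ ∑ i, x i ≤ 1}
  rw [volume_corner_simplex, hdet, abs_of_pos (inv_pos.2 hprod),
    ← ENNReal.ofReal_mul (inv_pos.2 hprod).le] at h1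
  convert h1 using 2
  · ext x
    simp only [Set.mem_ofPred_eq, Set.mem_preimage, Matrix.toLin'_apply, Matrix.mulVec_diagonal]
    simp only [mul_comm (h _), mul_nonneg_iff_of_pos_right (hpos _)]
  · field_simp

end Simplex

/-! ### Volume of a simplicial cone and index of its edge lattice -/

section Cone

variable {E : Type*} [NormedAddCommGroup E] [NormedSpace ℝ E] {ι : Type*} [Fintype ι]

/-- The volume of the part of height at most `1` of a simplicial cone. -/
theorem measureReal_truncated_cone [Nonempty ι] [FiniteDimensional ℝ E] [MeasurableSpace E]
    [BorelSpace E] (μ : Measure E) [μ.IsAddHaarMeasure] (b : Module.Basis ι ℝ E)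
    {m : Module.Dual ℝ E} {h : ι → ℕ} (hm : ∀ i, m (b i) = h i) (hpos : ∀ i, 0 < h i) :
    ((Fintype.card ι).factorial : ℝ) * μ.real {x | (∀ i, 0 ≤ b.repr x i) ∧ m x ≤ 1}
      = μ.real (ZSpan.fundamentalDomain b) / ∏ i, (h i : ℝ) := by
  have hpre (s : Set (ι → ℝ)) (hs : MeasurableSet s) :
      μ (b.equivFunL ⁻¹' s) = Measure.map b.equivFunL μ s :=
    (Measure.map_apply b.equivFunL.continuous.measurable hs).symm
  have hν := ContinuousLinearEquiv.isAddHaarMeasure_map b.equivFunL μ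
  -- In coordinates `μ` is a multiple of Lebesgue measure; the same factor `c` appears on both
  -- sides.
  have hsc := Measure.isAddLeftInvariant_eq_smul (Measure.map b.equivFunL μ) volume
  set c := (Measure.map b.equivFunL μ).addHaarScalarFactor volume
  have hF : ZSpan.fundamentalDomain b = b.equivFunL ⁻¹' (Set.univ.pi fun _ => Set.Ico (0 : ℝ) 1) := by
    ext x
    simp [ZSpan.mem_fundamentalDomain]
  have hT : {x | (∀ i, 0 ≤ b.repr x i) ∧ m x ≤ 1}
      = b.equivFunL ⁻¹' {y | (∀ i, 0 ≤ y i) ∧ ∑ i, y i * (h i : ℝ) ≤ 1} := by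
    ext x
    simp [height_eq_sum hm]
  have hmeas : MeasurableSet {y : ι → ℝ | (∀ i, 0 ≤ y i) ∧ ∑ i, y i * (h i : ℝ) ≤ 1} := by
    refine MeasurableSet.inter ?_ ?_
    · exact measurableSet_Ici (a := (0 : ι → ℝ))
    · exact measurableSet_le (Finset.measurable_sum _ fun i _ =>
        (measurable_pi_apply i).mul_const _) measurable_const
  have hpos' : ∀ i, (0 : ℝ) < h i := fun i => by exact_mod_cast hpos i
  have hprod : (0 : ℝ) < ∏ i, (h i : ℝ) := Finset.prod_pos fun i _ => hpos' i
  have hfac : (0 : ℝ) < (Fintype.card ι).factorial := by exact_mod_cast Nat.factorial_pos _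
  rw [hF, hT, Measure.real, Measure.real, hpre _ hmeas,
    hpre _ (MeasurableSet.univ_pi fun _ => measurableSet_Ico), hsc, Measure.smul_apply,
    Measure.smul_apply, volume_weighted_simplex hpos', Real.volume_pi_Ico]
  simp only [ENNReal.smul_def, smul_eq_mul, ENNReal.toReal_mul, sub_zero, ENNReal.ofReal_one,
    Finset.prod_const_one, ENNReal.toReal_one]
  rw [ENNReal.toReal_ofReal (by positivity)]
  field_simp

variable {N : Submodule ℤ E} {b : Module.Basis ι ℝ E} {J : Set ι}

/-- The lattice points of a half-open parallelepiped represent the cosets of the sublattice spanned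
by its edges. -/
theorem card_halfOpenSlab_inter (hb : ∀ i, b i ∈ N) :
    (halfOpenSlab b J Set.univ ∩ N).ncard
      = (Submodule.span ℤ (Set.range b)).toAddSubgroup.relIndex N.toAddSubgroup := by
  classical
  set L := Submodule.span ℤ (Set.range b) with hL
  have hmemL (x : E) : x ∈ L ↔ ∀ i, ∃ k : ℤ, (k : ℝ) = b.repr x i := by
    rw [hL, b.mem_span_iff_repr_mem ℤ]
    simp
  let f : ↥(halfOpenSlab b J Set.univ ∩ N) →
      N.toAddSubgroup ⧸ (L.toAddSubgroup.addSubgroupOf N.toAddSubgroup) :=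
    fun x => QuotientAddGroup.mk ⟨x.1, x.2.2⟩
  have hf : Function.Bijective f := by
    constructor
    · rintro ⟨x, hx, hxN⟩ ⟨y, hy, hyN⟩ hxy
      have h1 := QuotientAddGroup.eq.1 hxy
      rw [AddSubgroup.mem_addSubgroupOf] at h1
      have h2 : -x + y ∈ L := h1
      rw [hmemL] at h2
      refine Subtype.ext (b.ext_elem fun i => ?_)
      obtain ⟨k, hk⟩ := h2 i
      rw [map_add, map_neg, Finsupp.add_apply, Finsupp.neg_apply] at hk
      -- Two points of a half-open interval of length `1` differ by less than `1`.
      have hk1 : |(k : ℝ)| < 1 := by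
        have hx1 := hx.1 i
        have hx2 := hx.2 i (Set.mem_univ i)
        have hy1 := hy.1 i
        have hy2 := hy.2 i (Set.mem_univ i)
        rw [hk, abs_lt]
        by_cases hi : i ∈ J
        · constructor <;> linarith [hx1.1 hi, hx2.1 hi, hy1.1 hi, hy2.1 hi]
        · constructor <;> linarith [hx1.2 hi, hx2.2 hi, hy1.2 hi, hy2.2 hi]
      have hk0 : k = 0 := by
        rw [← Int.abs_lt_one_iff]
        exact_mod_cast hk1
      rw [hk0, Int.cast_zero] at hk
      simp only
      linarith
    · intro q
      obtain ⟨⟨y, hyN⟩, rfl⟩ := QuotientAddGroup.mk_surjective q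
      -- The floor reduces a coordinate into `[0, 1)`, the ceiling minus one into `(0, 1]`.
      set κ : ι → ℤ := fun i => if i ∈ J then ⌊b.repr y i⌋ else ⌈b.repr y i⌉ - 1 with hκ
      set z : E := ∑ i, κ i • b i with hz
      have hzN : z ∈ N := N.sum_mem fun i _ => N.smul_mem _ (hb i)
      have hcz (i : ι) : b.repr z i = κ i := by
        rw [hz, map_sum, Finsupp.finsetSum_apply]
        simp only [← Int.cast_smul_eq_zsmul ℝ, map_smul, Finsupp.smul_apply, b.repr_self,
          Finsupp.single_apply, smul_eq_mul, mul_ite, mul_one, mul_zero]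
        simp
      refine ⟨⟨y - z, ⟨⟨fun i => ?_, fun i _ => ?_⟩, N.sub_mem hyN hzN⟩⟩, ?_⟩
      · rw [map_sub, Finsupp.sub_apply, hcz]
        refine ⟨fun hi => ?_, fun hi => ?_⟩
        · simp only [hκ, if_pos hi]
          linarith [Int.floor_le (b.repr y i)]
        · simp only [hκ, if_neg hi]
          push_cast
          linarith [Int.ceil_lt_add_one (b.repr y i)]
      · rw [map_sub, Finsupp.sub_apply, hcz]
        refine ⟨fun hi => ?_, fun hi => ?_⟩
        · simp only [hκ, if_pos hi]
          linarith [Int.lt_floor_add_one (b.repr y i)]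
        · simp only [hκ, if_neg hi]
          push_cast
          linarith [Int.le_ceil (b.repr y i)]
      · refine QuotientAddGroup.eq.2 ?_
        rw [AddSubgroup.mem_addSubgroupOf]
        change -(y - z) + y ∈ L
        rw [hmemL]
        intro i
        exact ⟨κ i, by rw [neg_sub, sub_add_cancel, hcz]⟩
  rw [AddSubgroup.relIndex, AddSubgroup.index, ← Nat.card_congr (Equiv.ofBijective f hf)]
  rfl

/-- The index is the determinant of `b` in a basis of `N`, up to sign; the covolume involves the
determinant of that basis in `b`. The two are inverse to each other. -/
theorem measureReal_fundamentalDomain_eq_relIndex_mul_covolume [FiniteDimensional ℝ E]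
    [MeasurableSpace E] [BorelSpace E] (μ : Measure E) [μ.IsAddHaarMeasure] [DiscreteTopology N]
    [IsZLattice ℝ N] (hb : ∀ i, b i ∈ N) :
    μ.real (ZSpan.fundamentalDomain b)
      = (Submodule.span ℤ (Set.range b)).toAddSubgroup.relIndex N.toAddSubgroup
        * ZLattice.covolume N μ := by
  classical
  have := ZLattice.module_finite ℝ N
  have := ZLattice.module_free ℝ N
  let bN₀ := Module.Free.chooseBasis ℤ N
  let bN : Module.Basis ι ℤ N := bN₀.reindex ((bN₀.ofZLatticeBasis ℝ N).indexEquiv b)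
  have hle : Submodule.span ℤ (Set.range b) ≤ N := by
    rw [Submodule.span_le]
    rintro _ ⟨i, rfl⟩
    exact hb i
  rw [ZLattice.covolume_eq_det_mul_measureReal N μ bN b,
    AddSubgroup.relIndex_eq_natAbs_det _ _ (fun x hx => hle hx) (b.restrictScalars ℤ) bN,
    Nat.cast_natAbs, Int.cast_abs]
  have h1 : ((bN.det fun i => ⟨((b.restrictScalars ℤ) i : E), hle (SetLike.coe_mem _)⟩ : ℤ) : ℝ)
      = (bN.ofZLatticeBasis ℝ N).det b := by
    rw [Module.Basis.det_apply, Module.Basis.det_apply, Int.cast_det]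
    congr 1
    ext i j
    rw [Matrix.map_apply, Module.Basis.toMatrix_apply, Module.Basis.toMatrix_apply]
    have := bN.ofZLatticeBasis_repr_apply ℝ N ⟨b j, hb j⟩ i
    rw [this]
    congr
    simp
  have h2 : (Subtype.val ∘ bN : ι → E) = bN.ofZLatticeBasis ℝ N := by
    ext i
    simp
  have h3 : (bN.ofZLatticeBasis ℝ N).det b * b.det (bN.ofZLatticeBasis ℝ N) = 1 := by
    rw [Module.Basis.det_mul_det, Module.Basis.det_self]
  rw [← mul_assoc]
  erw [h1]
  rw [h2, ← abs_mul, h3, abs_one, one_mul]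

/-- At `1` the numerator counts all lattice points of the parallelepiped, because their heights are
integers between `0` and `∑ h i`. -/
theorem eval_one_slabPolynomial {m : Module.Dual ℝ E} {h : ι → ℕ} (hb : ∀ i, b i ∈ N)
    (hm : ∀ i, m (b i) = h i) (hmN : ∀ n ∈ N, ∃ k : ℤ, m n = k)
    (hfin : ∀ k, (level N (halfOpenCone b J) m k).Finite) :
    (slabPolynomial N b J m h).eval 1
      = ((Submodule.span ℤ (Set.range b)).toAddSubgroup.relIndex N.toAddSubgroup : ℚ) := by
  rw [← card_halfOpenSlab_inter (J := J) hb, slabPolynomial, Polynomial.eval_finsetSum]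
  simp only [Polynomial.eval_monomial, one_pow, mul_one]
  have h1 := (Finset.range (∑ i, h i + 1)).finite_toSet.ncard_biUnion
    (s := fun k : ℕ => level N (halfOpenSlab b J Set.univ) m (k : ℤ))
    (fun k _ => (hfin k).subset (level_mono (fun x hx => hx.1) k)) ?_
  · rw [finsum_mem_coe_finset] at h1
    rw [← Nat.cast_sum, ← h1]
    congr 2
    ext x
    simp only [Set.mem_iUnion, Finset.mem_coe, Finset.mem_range, exists_prop]
    constructor
    · rintro ⟨k, -, hx⟩
      exact ⟨hx.1, hx.2.1⟩
    · rintro ⟨hx, hxN⟩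
      obtain ⟨k, hk⟩ := hmN x hxN
      have h2 : m x ≤ (∑ i, h i : ℕ) := by
        rw [height_eq_sum hm]
        push_cast
        refine Finset.sum_le_sum fun i _ => ?_
        have h2 : b.repr x i ≤ 1 := by
          by_cases hi : i ∈ J
          · exact ((hx.2 i (Set.mem_univ i)).1 hi).le
          · exact (hx.2 i (Set.mem_univ i)).2 hi
        exact mul_le_of_le_one_left (Nat.cast_nonneg _) h2
      have h3 : 0 ≤ m x := by
        rw [height_eq_sum hm]
        exact Finset.sum_nonneg fun i _ =>
          mul_nonneg (halfOpenCone_coord_nonneg hx.1 i) (Nat.cast_nonneg _)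
      rw [hk] at h2 h3
      have h4 : 0 ≤ k := by exact_mod_cast h3
      have h5 : k ≤ (∑ i, h i : ℕ) := by exact_mod_cast h2
      exact ⟨k.toNat, by omega, hx, hxN, by rw [hk, Int.toNat_of_nonneg h4]⟩
  · intro k _ k' _ hne
    refine Set.disjoint_left.2 fun x hx hx' => hne ?_
    have := hx.2.2.symm.trans hx'.2.2
    exact_mod_cast this

end Cone

/-! ### Regular triangulations from generic weights -/

section Triangulation

variable {E : Type*} [NormedAddCommGroup E] [NormedSpace ℝ E] {ι : Type*}

/-- The subfamilies of `v` that form a basis. -/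
def BasisIndex (v : ι → E) : Type _ :=
  {B : Finset ι // LinearIndependent ℝ (fun i : B => v i) ∧
    ⊤ ≤ Submodule.span ℝ (Set.range fun i : B => v i)}

variable {v : ι → E}

/-- The basis given by a subfamily. -/
noncomputable def BasisIndex.basis (B : BasisIndex v) : Module.Basis B.1 ℝ E :=
  Module.Basis.mk B.2.1 B.2.2

@[simp]
theorem BasisIndex.basis_apply (B : BasisIndex v) (i : B.1) : B.basis i = v i := by
  simp [BasisIndex.basis]

open Classical in
/-- The coordinates with respect to a subfamily that is a basis, extended by zero. -/
noncomputable def BasisIndex.coord (B : BasisIndex v) : E →ₗ[ℝ] ι → ℝ :=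
  LinearMap.pi fun i => if h : i ∈ B.1 then B.basis.coord ⟨i, h⟩ else 0

theorem BasisIndex.coord_coe (B : BasisIndex v) (x : E) (i : B.1) :
    B.coord x i = B.basis.repr x i := by
  simp [BasisIndex.coord]

theorem BasisIndex.coord_of_notMem (B : BasisIndex v) (x : E) {i : ι} (hi : i ∉ B.1) :
    B.coord x i = 0 := by
  simp [BasisIndex.coord, hi]

/-- A point is generic if it lies on no hyperplane spanned by members of the family. -/
def IsGeneric (v : ι → E) (y : E) : Prop :=
  ∀ B : BasisIndex v, ∀ i ∈ B.1, B.coord y i ≠ 0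

variable [Fintype ι]

instance : Finite (BasisIndex v) := Subtype.finite

theorem BasisIndex.sum_coord_smul (B : BasisIndex v) (x : E) : ∑ i, B.coord x i • v i = x := by
  classical
  rw [← Finset.sum_subset (Finset.subset_univ B.1) fun i _ hi => by
    rw [B.coord_of_notMem x hi, zero_smul], ← Finset.sum_coe_sort]
  simp only [B.coord_coe]
  conv_rhs => rw [← B.basis.sum_repr x]
  simp

theorem BasisIndex.coord_eq (B : BasisIndex v) {a : ι → ℝ} (ha : ∀ i, i ∉ B.1 → a i = 0) {x : E}
    (hx : ∑ i, a i • v i = x) : B.coord x = a := by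
  classical
  have h1 : ∑ i : B.1, a i • B.basis i = x := by
    simp only [B.basis_apply]
    rw [← hx, ← Finset.sum_subset (Finset.subset_univ B.1) fun i _ hi => by
      rw [ha i hi, zero_smul]]
    exact Finset.sum_coe_sort B.1 fun i => a i • v i
  ext i
  by_cases hi : i ∈ B.1
  · have := B.coord_coe x ⟨i, hi⟩
    rw [this, ← h1, B.basis.repr_sum_self]
  · rw [B.coord_of_notMem x hi, ha i hi]

theorem BasisIndex.coord_apply_self [DecidableEq ι] (B : BasisIndex v) {j : ι} (hj : j ∈ B.1) :
    B.coord (v j) = Pi.single j 1 := by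
  refine B.coord_eq (fun i hi => ?_) (by simp [Pi.single_apply])
  exact Pi.single_eq_of_ne (by rintro rfl; exact hi hj) 1

/-- The linear functional with values `w i` at `v i`, `i ∈ B`. -/
noncomputable def BasisIndex.cost (B : BasisIndex v) (w : ι → ℝ) : E →ₗ[ℝ] ℝ :=
  (∑ i, w i • LinearMap.proj i : (ι → ℝ) →ₗ[ℝ] ℝ) ∘ₗ B.coord

theorem BasisIndex.cost_apply (B : BasisIndex v) (w : ι → ℝ) (x : E) :
    B.cost w x = ∑ i, w i * B.coord x i := by
  simp [BasisIndex.cost]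

theorem BasisIndex.cost_apply_self (B : BasisIndex v) (w : ι → ℝ) {j : ι} (hj : j ∈ B.1) :
    B.cost w (v j) = w j := by
  classical
  rw [B.cost_apply, B.coord_apply_self hj]
  simp [Pi.single_apply]

/-- Each forbidden equality cuts out a proper subspace of weights, and finitely many proper
subspaces do not cover a real vector space. -/
theorem exists_generic_weight (v : ι → E) :
    ∃ w : ι → ℝ, ∀ B : BasisIndex v, ∀ j, j ∉ B.1 → B.cost w (v j) ≠ w j := by
  classical
  by_contra! hcon
  let φ (p : Σ B : BasisIndex v, {j // j ∉ B.1}) : (ι → ℝ) →ₗ[ℝ] ℝ :=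
    (∑ i, p.1.coord (v p.2) i • LinearMap.proj i) - LinearMap.proj p.2.1
  have hφ (p) (w : ι → ℝ) : φ p w = p.1.cost w (v p.2) - w p.2 := by
    simp [φ, BasisIndex.cost_apply, mul_comm]
  have hcover : ⋃ p, ((LinearMap.ker (φ p) : Submodule ℝ (ι → ℝ)) : Set (ι → ℝ)) = Set.univ := by
    refine Set.eq_univ_of_forall fun w => ?_
    obtain ⟨B, j, hj, hw⟩ := hcon w
    refine Set.mem_iUnion.2 ⟨⟨B, j, hj⟩, ?_⟩
    rw [SetLike.mem_coe, LinearMap.mem_ker, hφ, hw, sub_self]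
  obtain ⟨⟨B, j, hj⟩, htop⟩ := Subspace.exists_eq_top_of_iUnion_eq_univ hcover
  -- This weight vanishes on `B`, as `j ∉ B`, so `φ` takes the value `-1` at it.
  have h1 : Pi.single j (1 : ℝ) ∈ LinearMap.ker (φ ⟨B, j, hj⟩) := htop ▸ Submodule.mem_top
  rw [LinearMap.mem_ker, hφ, B.cost_apply] at h1
  simp [Pi.single_apply, B.coord_of_notMem _ hj] at h1

/-- The representations of `y` as a non-negative combination of the family `v`. -/
def representations (v : ι → E) (y : E) : Set (ι → ℝ) :=
  {a | (∀ i, 0 ≤ a i) ∧ ∑ i, a i • v i = y}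

/-- Heights add up to `m y` and are positive on the family, which bounds every coefficient. -/
theorem isCompact_representations {m : Module.Dual ℝ E} (hm : ∀ i, 0 < m (v i)) (y : E) :
    IsCompact (representations v y) := by
  refine (isCompact_Icc (a := (0 : ι → ℝ)) (b := fun i => m y / m (v i))).of_isClosed_subset ?_ ?_
  · refine IsClosed.inter (isClosed_Ici (a := (0 : ι → ℝ))) ?_
    exact isClosed_eq (by fun_prop) continuous_const
  · rintro a ⟨ha, hy⟩
    refine ⟨ha, fun i => ?_⟩
    rw [le_div_iff₀ (hm i), ← hy, map_sum]
    simp only [map_smul, smul_eq_mul]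
    exact Finset.single_le_sum (f := fun i => a i * m (v i))
      (fun j _ => mul_nonneg (ha j) (hm j).le) (Finset.mem_univ i)

theorem exists_pos_forall_nonneg_add {a c : ι → ℝ} (ha : ∀ i, 0 ≤ a i)
    (hc : ∀ i, a i = 0 → 0 ≤ c i) : ∃ ε > 0, ∀ i, 0 ≤ a i + ε * c i := by
  have h1 : ∀ᶠ ε in 𝓝[>] (0 : ℝ), ∀ i, 0 ≤ a i + ε * c i := by
    refine eventually_all.2 fun i => ?_
    rcases (ha i).eq_or_lt with h0 | h0
    · filter_upwards [self_mem_nhdsWithin] with ε hε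
      rw [← h0, zero_add]
      exact mul_nonneg (le_of_lt hε) (hc i h0.symm)
    · have : Tendsto (fun ε : ℝ => a i + ε * c i) (𝓝[>] 0) (𝓝 (a i + 0 * c i)) :=
        Continuous.tendsto' (by fun_prop) _ _ rfl |>.mono_left nhdsWithin_le_nhds
      rw [zero_mul, add_zero] at this
      exact (this.eventually (lt_mem_nhds h0)).mono fun _ h => h.le
  obtain ⟨ε, h, hε⟩ := (h1.and self_mem_nhdsWithin).exists
  exact ⟨ε, hε, h⟩

/-- An optimal representation whose support is linearly independent. -/
theorem exists_optimal_representation {m : Module.Dual ℝ E} (hm : ∀ i, 0 < m (v i)) (w : ι → ℝ)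
    {y : E} (hy : (representations v y).Nonempty) :
    ∃ a ∈ representations v y, (∀ a' ∈ representations v y, ∑ i, w i * a i ≤ ∑ i, w i * a' i) ∧
      LinearIndepOn ℝ v {i | a i ≠ 0} := by
  have hP := isCompact_representations hm y
  have hcont : Continuous fun a : ι → ℝ => ∑ i, w i * a i := by fun_prop
  obtain ⟨a₀, ha₀, hmin⟩ := hP.exists_isMinOn hy hcont.continuousOn
  set F := representations v y ∩ {a | ∑ i, w i * a i = ∑ i, w i * a₀ i} with hF
  have hFc : IsCompact F := hP.inter_right (isClosed_eq hcont continuous_const)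
  -- An extreme point of the optimal face works: a linear relation `l` on its support would allow a
  -- move inside the face in both directions.
  obtain ⟨a, haF, hext⟩ := hFc.extremePoints_nonempty ⟨a₀, ha₀, rfl⟩
  have hopt : ∀ a' ∈ representations v y, ∑ i, w i * a i ≤ ∑ i, w i * a' i := fun a' ha' => by
    rw [haF.2]
    exact hmin ha'
  refine ⟨a, haF.1, hopt, ?_⟩
  rw [linearIndepOn_iff]
  intro l hl hl0
  rw [Finsupp.linearCombination_apply, Finsupp.sum_fintype _ _ (by simp)] at hl0
  have hsupp : ∀ i, a i = 0 → l i = 0 := fun i hi => by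
    by_contra hne
    exact (hl (Finsupp.mem_support_iff.2 hne)) hi
  obtain ⟨ε₁, hε₁, h₁⟩ := exists_pos_forall_nonneg_add (c := fun i => l i) haF.1.1
    fun i hi => (hsupp i hi).ge
  obtain ⟨ε₂, hε₂, h₂⟩ := exists_pos_forall_nonneg_add (c := fun i => -l i) haF.1.1
    fun i hi => by simp [hsupp i hi]
  have hmem (t : ℝ) (ht : ∀ i, 0 ≤ a i + t * l i) :
      (fun i => a i + t * l i) ∈ representations v y := by
    refine ⟨ht, ?_⟩
    simp only [add_smul, mul_smul, Finset.sum_add_distrib, haF.1.2, ← Finset.smul_sum, hl0,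
      smul_zero, add_zero]
  have hcost (t : ℝ) : ∑ i, w i * (a i + t * l i) = ∑ i, w i * a i + t * ∑ i, w i * l i := by
    rw [Finset.mul_sum, ← Finset.sum_add_distrib]
    exact Finset.sum_congr rfl fun i _ => by ring
  have h₂' : ∀ i, 0 ≤ a i + (-ε₂) * l i := fun i => by simpa using h₂ i
  -- Neither direction lowers the cost, so `l` has cost zero.
  have hzero : ∑ i, w i * l i = 0 := by
    have e1 := hopt _ (hmem ε₁ h₁)
    have e2 := hopt _ (hmem (-ε₂) h₂')
    rw [hcost] at e1 e2
    nlinarith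
  have hin (t : ℝ) (ht : ∀ i, 0 ≤ a i + t * l i) : (fun i => a i + t * l i) ∈ F :=
    ⟨hmem t ht, by
      show ∑ i, w i * (a i + t * l i) = _
      rw [hcost, hzero, mul_zero, add_zero]
      exact haF.2⟩
  have hseg : a ∈ openSegment ℝ (fun i => a i + ε₁ * l i) (fun i => a i + (-ε₂) * l i) := by
    refine ⟨ε₂ / (ε₁ + ε₂), ε₁ / (ε₁ + ε₂), by positivity, by positivity, by field_simp; ring, ?_⟩
    ext i
    simp only [Pi.add_apply, Pi.smul_apply, smul_eq_mul]
    field_simp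
    ring
  have h3 := hext (hin _ h₁) (hin _ h₂') hseg
  ext i
  have h4 := congrFun h3 i
  simp only [add_eq_left, mul_eq_zero, hε₁.ne', false_or] at h4
  simpa using h4

/-- A family of bases whose cones cover the cone over `v` and overlap only in non-generic points:
the regular triangulation given by a generic weight. -/
theorem exists_generic_triangulation {m : Module.Dual ℝ E} (hm : ∀ i, 0 < m (v i))
    (hspan : Submodule.span ℝ (Set.range v) = ⊤) :
    ∃ T : Finset (BasisIndex v), ∀ y, IsGeneric v y →
      ((representations v y).Nonempty → ∃ B ∈ T, ∀ i, 0 ≤ B.coord y i) ∧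
      ∀ B ∈ T, ∀ B' ∈ T, (∀ i, 0 ≤ B.coord y i) → (∀ i, 0 ≤ B'.coord y i) → B = B' := by
  classical
  obtain ⟨w, hw⟩ := exists_generic_weight v
  have hfin := Fintype.ofFinite (BasisIndex v)
  -- These are the lower facets of the lifted cone: the functional interpolating `w` on `B` lies
  -- strictly below `w` on all other generators.
  refine ⟨Finset.univ.filter fun B => ∀ j, j ∉ B.1 → B.cost w (v j) < w j, fun y hy => ⟨?_, ?_⟩⟩
  · intro hne
    obtain ⟨a, ha, hopt, hli⟩ := exists_optimal_representation hm w hne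
    obtain ⟨B₀, -, hsub, hsp, hB₀⟩ := exists_linearIndepOn_extension hli (Set.subset_univ _)
    let B : BasisIndex v := ⟨B₀.toFinset, by
      refine ⟨?_, ?_⟩
      · have : LinearIndepOn ℝ v (B₀.toFinset : Set ι) := by rwa [Set.coe_toFinset]
        exact this
      · have h1 : (Set.range fun i : B₀.toFinset => v i) = v '' B₀ := by
          ext x; simp
        rw [h1, ← hspan, Submodule.span_le, ← Set.image_univ]
        exact hsp⟩
    have hB (i : ι) : i ∈ B.1 ↔ i ∈ B₀ := Set.mem_toFinset
    have hcoord : B.coord y = a := B.coord_eq (fun i hi => by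
      by_contra hne
      exact hi ((hB i).2 (hsub hne))) ha.2
    refine ⟨B, Finset.mem_filter.2 ⟨Finset.mem_univ _, fun j hj => ?_⟩, by rw [hcoord]; exact ha.1⟩
    refine lt_of_le_of_ne ?_ (hw B j hj)
    by_contra! hlt
    -- A simplex pivot: bring in `v j` and compensate inside `B`. Genericity of `y` makes all
    -- coefficients on `B` positive, so a small step is feasible and would lower the cost.
    set c : ι → ℝ := Pi.single j 1 - B.coord (v j) with hc
    obtain ⟨ε, hε, hnn⟩ := exists_pos_forall_nonneg_add (c := c) ha.1 fun i hi => by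
      have hiB : i ∉ B.1 := fun hiB => hy B i hiB (by rw [hcoord, hi])
      rw [hc, Pi.sub_apply, B.coord_of_notMem _ hiB, sub_zero]
      exact (Pi.single_nonneg.2 zero_le_one : (0 : ι → ℝ) ≤ Pi.single j 1) i
    have hcsum : ∑ i, c i • v i = 0 := by
      simp only [hc, Pi.sub_apply, sub_smul, Finset.sum_sub_distrib, B.sum_coord_smul]
      simp [Pi.single_apply]
    have hccost : ∑ i, w i * c i = w j - B.cost w (v j) := by
      simp only [hc, Pi.sub_apply, mul_sub, Finset.sum_sub_distrib, B.cost_apply]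
      simp [Pi.single_apply]
    have h1 := hopt (fun i => a i + ε * c i) ⟨hnn, by
      simp only [add_smul, mul_smul, Finset.sum_add_distrib, ha.2, ← Finset.smul_sum, hcsum,
        smul_zero, add_zero]⟩
    have h2 : ∑ i, w i * (a i + ε * c i) = ∑ i, w i * a i + ε * ∑ i, w i * c i := by
      rw [Finset.mul_sum, ← Finset.sum_add_distrib]
      exact Finset.sum_congr rfl fun i _ => by ring
    rw [h2, hccost] at h1
    nlinarith
  -- Weak duality: `B'.cost w` is at most `w` on every generator, hence at most the cost of the
  -- representation of `y` by `B`. Equality forces `B ⊆ B'`, as `y` has positive coordinates on `B`.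
  · have key : ∀ B B' : BasisIndex v, (∀ j, j ∉ B'.1 → B'.cost w (v j) < w j) →
        (∀ i, 0 ≤ B.coord y i) →
        B'.cost w y ≤ B.cost w y ∧ (B'.cost w y = B.cost w y → B.1 ⊆ B'.1) := by
      intro B B' hB' hyB
      have hle : ∀ i, B'.cost w (v i) ≤ w i := fun i => by
        by_cases hi : i ∈ B'.1
        · exact (B'.cost_apply_self w hi).le
        · exact (hB' i hi).le
      have e1 : B'.cost w y = ∑ i, B'.cost w (v i) * B.coord y i := by
        conv_lhs => rw [← B.sum_coord_smul y]
        rw [map_sum]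
        exact Finset.sum_congr rfl fun i _ => by rw [map_smul, smul_eq_mul, mul_comm]
      rw [e1, B.cost_apply]
      refine ⟨Finset.sum_le_sum fun i _ => mul_le_mul_of_nonneg_right (hle i) (hyB i), ?_⟩
      intro heq i hi
      by_contra hi'
      refine (Finset.sum_lt_sum (fun i _ => mul_le_mul_of_nonneg_right (hle i) (hyB i))
        ⟨i, Finset.mem_univ i, ?_⟩).ne heq
      exact mul_lt_mul_of_pos_right (hB' i hi') (lt_of_le_of_ne (hyB i) (hy B i hi).symm)
    intro B hB B' hB' hyB hyB'
    have h1 := key B B' (Finset.mem_filter.1 hB').2 hyB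
    have h2 := key B' B (Finset.mem_filter.1 hB).2 hyB'
    have h3 := le_antisymm h1.1 h2.1
    exact Subtype.ext (Finset.Subset.antisymm (h1.2 h3) (h2.2 h3.symm))

end Triangulation

/-! ### Half-open decompositions and additivity of volume -/

section Decomposition

variable {E : Type*} [NormedAddCommGroup E] [NormedSpace ℝ E] {ι : Type*} {v : ι → E}

/-- For small `ε` the sign of `a + ε c` is that of `a`, and that of `c` when `a = 0`. This decides
which facets a half-open cone keeps. -/
theorem eventually_nonneg_add_mul_iff (a : ℝ) {c : ℝ} (hc : c ≠ 0) :
    ∀ᶠ ε in 𝓝[>] (0 : ℝ), (0 ≤ a + ε * c ↔ (0 < c → 0 ≤ a) ∧ (¬ 0 < c → 0 < a)) := by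
  have hcont : Tendsto (fun ε : ℝ => a + ε * c) (𝓝[>] 0) (𝓝 a) :=
    (Continuous.tendsto' (by fun_prop) _ _ (by simp)).mono_left nhdsWithin_le_nhds
  rcases lt_trichotomy a 0 with ha | ha | ha
  · filter_upwards [hcont.eventually (gt_mem_nhds ha)] with ε hε
    constructor
    · intro h; linarith
    · rintro ⟨h1, h2⟩
      by_cases h0 : 0 < c
      · linarith [h1 h0]
      · linarith [h2 h0]
  · filter_upwards [self_mem_nhdsWithin] with ε hε
    rw [ha, zero_add, mul_nonneg_iff_of_pos_left hε]
    constructor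
    · exact fun h => ⟨fun _ => le_rfl, fun h' => absurd (lt_of_le_of_ne h hc.symm) h'⟩
    · rintro ⟨-, h2⟩
      by_contra h3
      exact lt_irrefl _ (h2 fun h4 => h3 h4.le)
  · filter_upwards [hcont.eventually (lt_mem_nhds ha)] with ε hε
    exact ⟨fun _ => ⟨fun _ => ha.le, fun _ => ha⟩, fun _ => hε.le⟩

variable [Fintype ι]

theorem eventually_coord_nonneg_iff (B : BasisIndex v) {q : E} (hq : IsGeneric v q) (x : E) :
    ∀ᶠ ε in 𝓝[>] (0 : ℝ), ((∀ i, 0 ≤ B.coord (x + ε • q) i) ↔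
      x ∈ halfOpenCone B.basis {i | 0 < B.coord q i}) := by
  have h1 : ∀ᶠ ε in 𝓝[>] (0 : ℝ), ∀ i : B.1, (0 ≤ B.coord x i + ε * B.coord q i ↔
      (0 < B.coord q i → 0 ≤ B.coord x i) ∧ (¬ 0 < B.coord q i → 0 < B.coord x i)) :=
    eventually_all.2 fun i => eventually_nonneg_add_mul_iff _ (hq B i i.2)
  filter_upwards [h1] with ε hε
  have h2 : (∀ i, 0 ≤ B.coord (x + ε • q) i) ↔
      ∀ i : B.1, 0 ≤ B.coord x i + ε * B.coord q i := by
    simp only [map_add, map_smul, Pi.add_apply, Pi.smul_apply, smul_eq_mul]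
    refine ⟨fun h i => h i, fun h i => ?_⟩
    by_cases hi : i ∈ B.1
    · exact h ⟨i, hi⟩
    · simp [B.coord_of_notMem _ hi]
  rw [h2]
  refine forall_congr' fun i => ?_
  rw [hε i, ← B.coord_coe]
  rfl

theorem eventually_isGeneric {q : E} (hq : IsGeneric v q) (x : E) :
    ∀ᶠ ε in 𝓝[>] (0 : ℝ), IsGeneric v (x + ε • q) := by
  refine eventually_all.2 fun B => eventually_all.2 fun i => ?_
  by_cases hi : i ∈ B.1
  · have hne := hq B i hi
    have h1 : ∀ᶠ ε in 𝓝[>] (0 : ℝ), ε ≠ -B.coord x i / B.coord q i := by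
      rcases le_or_gt (-B.coord x i / B.coord q i) 0 with h | h
      · filter_upwards [self_mem_nhdsWithin] with ε hε
        exact (h.trans_lt hε).ne'
      · exact nhdsWithin_le_nhds ((gt_mem_nhds h).mono fun _ h => h.ne)
    filter_upwards [h1] with ε hε _ h0
    rw [map_add, map_smul, Pi.add_apply, Pi.smul_apply, smul_eq_mul] at h0
    refine hε ?_
    rw [eq_div_iff hne]
    linarith
  · exact Eventually.of_forall fun _ h => absurd h hi

/-- Shifting by a generic vector turns a triangulation into a decomposition into disjoint half-open
cones. -/
theorem halfOpen_decomposition {T : Finset (BasisIndex v)} {C D : Set E}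
    (hC : ∀ y, y ∈ C ↔ (representations v y).Nonempty)
    (hT : ∀ y, IsGeneric v y →
      ((representations v y).Nonempty → ∃ B ∈ T, ∀ i, 0 ≤ B.coord y i) ∧
      ∀ B ∈ T, ∀ B' ∈ T, (∀ i, 0 ≤ B.coord y i) → (∀ i, 0 ≤ B'.coord y i) → B = B')
    {q : E} (hq : IsGeneric v q)
    (hD : ∀ x, ∀ᶠ ε in 𝓝[>] (0 : ℝ), (x + ε • q ∈ C ↔ x ∈ D)) (x : E) :
    (x ∈ D ↔ ∃ B ∈ T, x ∈ halfOpenCone B.basis {i | 0 < B.coord q i}) ∧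
    ∀ B ∈ T, ∀ B' ∈ T, x ∈ halfOpenCone B.basis {i | 0 < B.coord q i} →
      x ∈ halfOpenCone B'.basis {i | 0 < B'.coord q i} → B = B' := by
  have h1 : ∀ᶠ ε in 𝓝[>] (0 : ℝ), ∀ B : BasisIndex v, ((∀ i, 0 ≤ B.coord (x + ε • q) i) ↔
      x ∈ halfOpenCone B.basis {i | 0 < B.coord q i}) :=
    eventually_all.2 fun B => eventually_coord_nonneg_iff B hq x
  -- As there are finitely many bases, a single `ε` serves all of them at the given `x`.
  obtain ⟨ε, ⟨h1, h2⟩, h3⟩ := ((h1.and (eventually_isGeneric hq x)).and (hD x)).exists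
  obtain ⟨h4, h5⟩ := hT _ h2
  simp only [← h1]
  refine ⟨?_, h5⟩
  rw [← h3, hC]
  refine ⟨h4, ?_⟩
  rintro ⟨B, -, hB⟩
  exact ⟨B.coord (x + ε • q), hB, B.sum_coord_smul _⟩

theorem measure_not_isGeneric [FiniteDimensional ℝ E] [MeasurableSpace E] [BorelSpace E]
    (μ : Measure E) [μ.IsAddHaarMeasure] : μ {y | ¬ IsGeneric v y} = 0 := by
  classical
  have h1 : {y | ¬ IsGeneric v y} ⊆ ⋃ B : BasisIndex v, ⋃ i : B.1,
      (LinearMap.ker (LinearMap.proj (i : ι) ∘ₗ B.coord : E →ₗ[ℝ] ℝ) : Set E) := by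
    intro y hy
    simp only [IsGeneric, not_forall, not_not, Set.mem_ofPred_eq] at hy
    obtain ⟨B, i, hi, h0⟩ := hy
    exact Set.mem_iUnion.2 ⟨B, Set.mem_iUnion.2 ⟨⟨i, hi⟩, by simpa using h0⟩⟩
  refine measure_mono_null h1 (measure_iUnion_null fun B => measure_iUnion_null fun i =>
    Measure.addHaar_submodule μ _ fun htop => ?_)
  have h2 : v i ∈ LinearMap.ker (LinearMap.proj (i : ι) ∘ₗ B.coord : E →ₗ[ℝ] ℝ) :=
    by rw [htop]; exact Submodule.mem_top
  rw [LinearMap.mem_ker, LinearMap.comp_apply, B.coord_apply_self i.2] at h2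
  simp at h2

/-- The volume of a triangulated cone below height `1`. -/
theorem measureReal_truncation_eq_sum [FiniteDimensional ℝ E] [MeasurableSpace E] [BorelSpace E]
    (μ : Measure E) [μ.IsAddHaarMeasure] {T : Finset (BasisIndex v)} {C : PointedCone ℝ E}
    (hC : ∀ y, y ∈ C ↔ (representations v y).Nonempty)
    (hT : ∀ y, IsGeneric v y →
      ((representations v y).Nonempty → ∃ B ∈ T, ∀ i, 0 ≤ B.coord y i) ∧
      ∀ B ∈ T, ∀ B' ∈ T, (∀ i, 0 ≤ B.coord y i) → (∀ i, 0 ≤ B'.coord y i) → B = B')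
    {m : Module.Dual ℝ E} (hcompact : IsCompact (truncation C m)) :
    μ.real (truncation C m) = ∑ B ∈ T, μ.real {x | (∀ i, 0 ≤ B.basis.repr x i) ∧ m x ≤ 1} := by
  have hcoord (B : BasisIndex v) (x : E) :
      (∀ i, 0 ≤ B.basis.repr x i) ↔ ∀ i, 0 ≤ B.coord x i := by
    simp only [← B.coord_coe]
    refine ⟨fun h i => ?_, fun h i => h i⟩
    by_cases hi : i ∈ B.1
    · exact h ⟨i, hi⟩
    · rw [B.coord_of_notMem _ hi]
  set K : BasisIndex v → Set E := fun B => {x | (∀ i, 0 ≤ B.coord x i) ∧ m x ≤ 1} with hK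
  have hKeq (B : BasisIndex v) : {x | (∀ i, 0 ≤ B.basis.repr x i) ∧ m x ≤ 1} = K B := by
    simp only [hcoord, hK]
  simp only [hKeq]
  have hsub (B : BasisIndex v) : K B ⊆ truncation C m := fun x hx =>
    ⟨(hC x).2 ⟨B.coord x, hx.1, B.sum_coord_smul x⟩, hx.2⟩
  have hgen : ∀ᵐ y ∂μ, IsGeneric v y := measure_not_isGeneric μ
  have hae : truncation C m =ᵐ[μ] ⋃ B ∈ T, K B := by
    filter_upwards [hgen] with y hy
    refine propext ⟨fun h => ?_, fun h => ?_⟩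
    · obtain ⟨B, hB, hyB⟩ := (hT y hy).1 ((hC y).1 h.1)
      exact Set.mem_biUnion hB ⟨hyB, h.2⟩
    · obtain ⟨B, hB, hyB⟩ := Set.mem_iUnion₂.1 h
      exact hsub B hyB
  have hclosed (B : BasisIndex v) : IsClosed (K B) := by
    have h1 : Continuous B.coord := LinearMap.continuous_of_finiteDimensional _
    have h2 : Continuous m := LinearMap.continuous_of_finiteDimensional _
    exact (isClosed_Ici.preimage h1 : IsClosed (B.coord ⁻¹' Set.Ici (0 : ι → ℝ))).inter
      (isClosed_le h2 continuous_const)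
  rw [measureReal_congr hae, Measure.real, measure_biUnion_finset₀ ?_
    fun B _ => (hclosed B).measurableSet.nullMeasurableSet, ENNReal.toReal_sum]
  · rfl
  · exact fun B _ => ((measure_mono (hsub B)).trans_lt hcompact.measure_lt_top).ne
  · intro B hB B' hB' hne
    refine measure_mono_null (t := {y | ¬ IsGeneric v y}) (fun y hy hgy => ?_)
      (measure_not_isGeneric μ)
    exact hne ((hT y hgy).2 B hB B' hB' hy.1.1 hy.2.1)

end Decomposition

/-! ### Behaviour at `t = 1` -/

section Limit

/-- Each `1 - t ^ h` is `1 - t` times a geometric sum whose value at `1` is `h`. -/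
theorem tendsto_value_div_cyclicDenom {ι : Type*} [Fintype ι] {h : ι → ℕ} (hpos : ∀ i, 0 < h i)
    (P : Polynomial ℚ) :
    Tendsto (fun t : ℝ => (1 - t) ^ Fintype.card ι *
      (P.eval₂ (algebraMap ℚ ℝ) t / (cyclicDenom h).eval₂ (algebraMap ℚ ℝ) t)) (𝓝[≠] 1)
      (𝓝 (((P.eval 1 : ℚ) : ℝ) / ∏ i, (h i : ℝ))) := by
  have h1 : Tendsto (fun t : ℝ => P.eval₂ (algebraMap ℚ ℝ) t /
      ∏ i, ∑ k ∈ Finset.range (h i), t ^ k) (𝓝[≠] 1)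
      (𝓝 (P.eval₂ (algebraMap ℚ ℝ) 1 / ∏ i, ∑ k ∈ Finset.range (h i), (1 : ℝ) ^ k)) := by
    refine Tendsto.mono_left ?_ nhdsWithin_le_nhds
    refine (P.continuous_eval₂ _).continuousAt.tendsto.div
      (Continuous.tendsto (by fun_prop) 1) ?_
    simp only [one_pow, Finset.sum_const, Finset.card_range, nsmul_eq_mul, mul_one]
    exact Finset.prod_ne_zero_iff.2 fun i _ => by exact_mod_cast (hpos i).ne'
  have h2 : P.eval₂ (algebraMap ℚ ℝ) 1 = ((P.eval 1 : ℚ) : ℝ) := by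
    have := Polynomial.eval₂_at_apply (p := P) (algebraMap ℚ ℝ) 1
    rwa [map_one] at this
  rw [h2] at h1
  simp only [one_pow, Finset.sum_const, Finset.card_range, nsmul_eq_mul, mul_one] at h1
  refine h1.congr' ?_
  filter_upwards [self_mem_nhdsWithin] with t ht
  have ht' : (1 - t) ≠ 0 := sub_ne_zero.2 (Ne.symm ht)
  rw [eval₂_cyclicDenom]
  have h3 : ∏ i, (1 - t ^ h i)
      = (1 - t) ^ Fintype.card ι * ∏ i, ∑ k ∈ Finset.range (h i), t ^ k := by
    rw [← Finset.card_univ, ← Finset.prod_const, ← Finset.prod_mul_distrib]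
    exact Finset.prod_congr rfl fun i _ => (mul_neg_geom_sum t (h i)).symm
  rw [h3, ← mul_div_assoc, mul_div_mul_left _ _ (pow_ne_zero _ ht')]

theorem eval₂_cyclicDenom_ne_zero {ι : Type*} [Fintype ι] {h : ι → ℕ} (hpos : ∀ i, 0 < h i)
    {t : ℝ} (ht : 0 < t) (ht1 : t ≠ 1) : (cyclicDenom h).eval₂ (algebraMap ℚ ℝ) t ≠ 0 := by
  rw [eval₂_cyclicDenom]
  refine Finset.prod_ne_zero_iff.2 fun i _ h0 => ht1 ?_
  exact (pow_eq_one_iff_of_nonneg ht.le (hpos i).ne').1 (by linarith)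

end Limit

/-! ### Cones with compact truncation -/

section Cone

variable {E : Type*} [NormedAddCommGroup E] [NormedSpace ℝ E] {C : PointedCone ℝ E}
  {m : Module.Dual ℝ E}

/-- Otherwise the whole ray through `x` would lie in the bounded set `C(1)`. -/
theorem pos_of_isCompact_truncation (hcompact : IsCompact (truncation C m)) {x : E} (hx : x ∈ C)
    (hx0 : x ≠ 0) : 0 < m x := by
  by_contra! hle
  obtain ⟨R, hR⟩ := hcompact.isBounded.exists_norm_le
  obtain ⟨n, hn⟩ := exists_nat_gt (R / ‖x‖)
  have h1 : (n : ℝ) • x ∈ truncation C m := by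
    refine ⟨PointedCone.smul_mem C (Nat.cast_nonneg n) hx, ?_⟩
    rw [map_smul, smul_eq_mul]
    nlinarith [Nat.cast_nonneg (α := ℝ) n]
  have h2 := hR _ h1
  rw [norm_smul, Real.norm_natCast] at h2
  rw [div_lt_iff₀ (norm_pos_iff.2 hx0)] at hn
  linarith

theorem smul_mem_cone {c : ℝ} (hc : 0 ≤ c) {x : E} (hx : x ∈ C) : c • x ∈ C :=
  PointedCone.smul_mem C hc hx

/-- The part of the cone of height at most `R` is a dilate of `C(1)`. -/
theorem isCompact_setOf_le (hcompact : IsCompact (truncation C m)) {R : ℝ} (hR : 0 < R) :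
    IsCompact {x | x ∈ C ∧ m x ≤ R} := by
  have : {x | x ∈ C ∧ m x ≤ R} = (R • ·) '' truncation C m := by
    ext x
    constructor
    · rintro ⟨hx, hmx⟩
      refine ⟨R⁻¹ • x, ⟨smul_mem_cone (inv_pos.2 hR).le hx, ?_⟩, smul_inv_smul₀ hR.ne' x⟩
      rw [map_smul, smul_eq_mul, inv_mul_le_iff₀ hR, mul_one]
      exact hmx
    · rintro ⟨y, ⟨hy, hmy⟩, rfl⟩
      refine ⟨smul_mem_cone hR.le hy, ?_⟩
      simp only [map_smul, smul_eq_mul]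
      nlinarith
  rw [this]
  exact hcompact.image (continuous_const_smul R)

theorem eventually_add_smul_mem_iff (hclosed : IsClosed (C : Set E)) {q : E} (hq : q ∈ C) (x : E) :
    ∀ᶠ ε in 𝓝[>] (0 : ℝ), (x + ε • q ∈ (C : Set E) ↔ x ∈ (C : Set E)) := by
  by_cases hx : x ∈ (C : Set E)
  · filter_upwards [self_mem_nhdsWithin] with ε hε
    exact ⟨fun _ => hx, fun _ => C.add_mem hx (smul_mem_cone (le_of_lt hε) hq)⟩
  · have h1 : Tendsto (fun ε : ℝ => x + ε • q) (𝓝[>] 0) (𝓝 x) :=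
      (Continuous.tendsto' (by fun_prop) _ _ (by simp)).mono_left nhdsWithin_le_nhds
    filter_upwards [h1.eventually (hclosed.isOpen_compl.mem_nhds hx)] with ε hε
    exact ⟨fun h => absurd h hε, fun h => absurd h hx⟩

theorem eventually_add_smul_neg_mem_iff {q : E} (hq : q ∈ interior (C : Set E)) (x : E) :
    ∀ᶠ ε in 𝓝[>] (0 : ℝ), (x + ε • (-q) ∈ (C : Set E) ↔ x ∈ interior (C : Set E)) := by
  by_cases hx : x ∈ interior (C : Set E)
  · have h1 : Tendsto (fun ε : ℝ => x + ε • (-q)) (𝓝[>] 0) (𝓝 x) :=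
      (Continuous.tendsto' (by fun_prop) _ _ (by simp)).mono_left nhdsWithin_le_nhds
    filter_upwards [h1.eventually (isOpen_interior.mem_nhds hx)] with ε hε
    exact ⟨fun _ => hx, fun _ => interior_subset hε⟩
  · filter_upwards [self_mem_nhdsWithin] with ε hε
    refine ⟨fun h => absurd ?_ hx, fun h => absurd h hx⟩
    have hε' : (0 : ℝ) < ε := hε
    rw [mem_interior]
    -- This open set is `(x - ε q) + ε C°`: it lies in `C` because `x - ε q` does, and it contains
    -- `x` because `q ∈ C°`.
    refine ⟨(fun y => ε⁻¹ • (y - (x + ε • (-q)))) ⁻¹' interior (C : Set E), ?_, ?_, ?_⟩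
    · intro y hy
      have h1 := C.add_mem h (smul_mem_cone hε'.le (interior_subset hy))
      rwa [smul_inv_smul₀ hε'.ne', add_sub_cancel] at h1
    · exact isOpen_interior.preimage (by fun_prop)
    · show ε⁻¹ • (x - (x + ε • (-q))) ∈ interior (C : Set E)
      rw [sub_add_cancel_left, smul_neg, inv_smul_smul₀ hε'.ne', neg_neg]
      exact hq

variable [FiniteDimensional ℝ E]

/-- Closedness is local, and near any point the heights are bounded, where `C` agrees with a compact
set. -/
theorem isClosed_of_isCompact_truncation (hcompact : IsCompact (truncation C m)) :
    IsClosed (C : Set E) := by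
  have hm : Continuous m := LinearMap.continuous_of_finiteDimensional _
  rw [← isOpen_compl_iff, isOpen_iff_mem_nhds]
  intro x hx
  have h1 := (isCompact_setOf_le hcompact (R := |m x| + 1) (by positivity)).isClosed
  have h2 : x ∉ {y | y ∈ C ∧ m y ≤ |m x| + 1} := fun h => hx h.1
  filter_upwards [h1.isOpen_compl.mem_nhds h2,
    hm.continuousAt.eventually (gt_mem_nhds (show m x < |m x| + 1 by linarith [le_abs_self (m x)]))]
    with y hy hy' hyC
  exact hy ⟨hyC, hy'.le⟩

theorem finite_level {N : Submodule ℤ E} [DiscreteTopology N]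
    (hcompact : IsCompact (truncation C m)) (k : ℤ) : (level N (C : Set E) m k).Finite := by
  have h1 := (isCompact_setOf_le hcompact (R := |(k : ℝ)| + 1) (by positivity)).isBounded
  have hclosed : IsClosed (N : Set E) := by
    have : DiscreteTopology N.toAddSubgroup := ‹DiscreteTopology N›
    exact AddSubgroup.isClosed_of_discrete (H := N.toAddSubgroup)
  refine (Metric.finite_isBounded_inter_isClosed (s := (N : Set E))
    DiscreteTopology.isDiscrete h1 hclosed).subset ?_
  rintro x ⟨hx, hN, hk⟩
  exact ⟨⟨hx, by rw [hk]; linarith [le_abs_self (k : ℝ)]⟩, hN⟩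

theorem interior_nonempty_of_span_eq_top (hdim : Submodule.span ℝ (C : Set E) = ⊤) :
    (interior (C : Set E)).Nonempty := by
  have hconv : Convex ℝ (C : Set E) := C.convex
  rw [hconv.interior_nonempty_iff_affineSpan_eq_top,
    AffineSubspace.affineSpan_eq_top_iff_vectorSpan_eq_top_of_nonempty ℝ E E ⟨0, C.zero_mem⟩,
    ← top_le_iff, ← hdim, Submodule.span_le]
  intro x hx
  have := vsub_mem_vectorSpan ℝ hx C.zero_mem
  simpa using this

end Cone

/-! ### Sums of cone functions: values and inversion -/

section Value

theorem value_sum_coneFunction_and_denom {E : Type*} [NormedAddCommGroup E] [NormedSpace ℝ E]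
    {β : Type*} {κ : β → Type*} [∀ B, Fintype (κ B)] (T : Finset β) (N : Submodule ℤ E)
    (m : Module.Dual ℝ E) (b : ∀ B, Module.Basis (κ B) ℝ E) (J : ∀ B, Set (κ B))
    (h : ∀ B, κ B → ℕ) (hpos : ∀ B i, 0 < h B i) {t : ℝ} (ht : 0 < t) (ht1 : t ≠ 1) :
    value (∑ B ∈ T, coneFunction N (b B) (J B) m (h B)) t
      = ∑ B ∈ T, (slabPolynomial N (b B) (J B) m (h B)).eval₂ (algebraMap ℚ ℝ) t /
          (cyclicDenom (h B)).eval₂ (algebraMap ℚ ℝ) t ∧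
    (∑ B ∈ T, coneFunction N (b B) (J B) m (h B)).denom.eval₂ (algebraMap ℚ ℝ) t ≠ 0 := by
  have h1 (B : β) := eval_algebraMap_div (algebraMap ℚ ℝ) t
    (P := slabPolynomial N (b B) (J B) m (h B)) (eval₂_cyclicDenom_ne_zero (hpos B) ht ht1)
  obtain ⟨h2, h3⟩ := eval_sum (algebraMap ℚ ℝ) t T
    (fun B => coneFunction N (b B) (J B) m (h B)) fun B _ => (h1 B).2
  exact ⟨h2.trans (Finset.sum_congr rfl fun B _ => (h1 B).1), h3⟩

theorem eval_inv_X_sum_coneFunction {E : Type*} [NormedAddCommGroup E] [NormedSpace ℝ E]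
    {β : Type*} {κ : β → Type*} [∀ B, Fintype (κ B)] {d : ℕ} (hd : ∀ B, Fintype.card (κ B) = d)
    (T : Finset β) {N : Submodule ℤ E}
    {m : Module.Dual ℝ E} (b : ∀ B, Module.Basis (κ B) ℝ E) (J : ∀ B, Set (κ B))
    (h : ∀ B, κ B → ℕ) (hb : ∀ B i, b B i ∈ N) (hm : ∀ B i, m (b B i) = h B i)
    (hpos : ∀ B i, 0 < h B i) :
    ((-1) ^ d * ∑ B ∈ T, coneFunction N (b B) (J B) m (h B)).eval
        RatFunc.C (RatFunc.X⁻¹ : RatFunc ℚ)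
      = ∑ B ∈ T, coneFunction N (b B) (J B)ᶜ m (h B) := by
  have h1 (B : β) := eval_algebraMap_div RatFunc.C (RatFunc.X⁻¹ : RatFunc ℚ)
    (P := slabPolynomial N (b B) (J B) m (h B))
    (eval₂_C_inv_X_ne_zero (cyclicDenom_ne_zero (hpos B)))
  obtain ⟨h2, h3⟩ := eval_sum RatFunc.C (RatFunc.X⁻¹ : RatFunc ℚ) T
    (fun B => coneFunction N (b B) (J B) m (h B)) fun B _ => (h1 B).2
  have h4 : ((-1) ^ d : RatFunc ℚ) = RatFunc.C ((-1) ^ d) := by simp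
  rw [h4, eval_C_mul _ _ _ _ h3, h2, ← h4, Finset.mul_sum]
  refine Finset.sum_congr rfl fun B _ => ?_
  rw [eval_inv_X_coneFunction (hb B) (hm B) (hpos B), hd, ← mul_assoc, ← mul_pow]
  simp

theorem value_neg_one_pow_mul (d : ℕ) {F : RatFunc ℚ} {t : ℝ}
    (hF : F.denom.eval₂ (algebraMap ℚ ℝ) t ≠ 0) : value ((-1) ^ d * F) t = (-1) ^ d * value F t := by
  have h4 : ((-1) ^ d : RatFunc ℚ) = RatFunc.C ((-1) ^ d) := by simp
  rw [value, h4, eval_C_mul _ _ _ _ hF, value]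
  simp

end Value

/-! ### Generators of the cone and primitive functionals -/

section Generators

variable {E : Type*} [NormedAddCommGroup E] [NormedSpace ℝ E]

theorem IsRationalPolyhedral.exists_nonzero_generators {N : Submodule ℤ E} {C : PointedCone ℝ E}
    (hC : IsRationalPolyhedral N C) :
    ∃ S : Finset E, (S : Set E) ⊆ N ∧ (0 : E) ∉ S ∧ C = PointedCone.hull ℝ (S : Set E) := by
  classical
  obtain ⟨S, hS, rfl⟩ := hC
  refine ⟨S.erase 0, fun x hx => hS (Finset.mem_of_mem_erase hx), Finset.notMem_erase 0 S, ?_⟩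
  refine le_antisymm (Submodule.span_le.2 fun x hx => ?_)
    (Submodule.span_mono fun x hx => Finset.mem_of_mem_erase hx)
  by_cases hx0 : x = 0
  · rw [hx0]
    exact Submodule.zero_mem _
  · exact Submodule.subset_span (Finset.mem_erase.2 ⟨hx0, hx⟩)

theorem mem_hull_range_iff {ι : Type*} [Fintype ι] (v : ι → E) (y : E) :
    y ∈ PointedCone.hull ℝ (Set.range v) ↔ (representations v y).Nonempty := by
  rw [PointedCone.hull, Submodule.mem_span_range_iff_exists_fun]
  constructor
  · rintro ⟨c, rfl⟩
    exact ⟨fun i => c i, fun i => (c i).2, rfl⟩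
  · rintro ⟨a, ha, rfl⟩
    exact ⟨fun i => ⟨a i, ha i⟩, rfl⟩

theorem span_range_eq_top_of_span_hull {ι : Type*} (v : ι → E)
    (h : Submodule.span ℝ (PointedCone.hull ℝ (Set.range v) : Set E) = ⊤) :
    Submodule.span ℝ (Set.range v) = ⊤ := by
  rw [← top_le_iff, ← h, Submodule.span_le]
  exact PointedCone.hull_le_span ℝ _

theorem IsPrimitive.ne_zero {N : Submodule ℤ E} {m : Module.Dual ℝ E} (hm : IsPrimitive N m) :
    m ≠ 0 := by
  rintro rfl
  exact not_isUnit_zero (hm.2 0 0 (Submodule.zero_mem _) (by simp))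

end Generators

end LatticeCone

/-! ### Assembly of the main theorem -/

open LatticeCone in
theorem mainTheorem11 {E : Type*} [NormedAddCommGroup E] [NormedSpace ℝ E]
    [FiniteDimensional ℝ E] [MeasurableSpace E] [BorelSpace E]
    (μ : Measure E) [μ.IsAddHaarMeasure]
    (d : ℕ) (hd : Module.finrank ℝ E = d)
    (N : Submodule ℤ E) [DiscreteTopology N] [IsZLattice ℝ N]
    (C : PointedCone ℝ E) (hC : LatticeCone.IsRationalPolyhedral N C)
    (hdim : Submodule.span ℝ (C : Set E) = ⊤)
    (hvertex : ∀ x ∈ C, -x ∈ C → x = 0)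
    (m : Module.Dual ℝ E) (hm : LatticeCone.IsPrimitive N m)
    (hcompact : IsCompact (LatticeCone.truncation C m)) :
    (∀ n ∈ C, n ∈ N → ∃ k : ℕ, m n = (k : ℝ)) ∧
    (∀ k : ℤ, (LatticeCone.level N (C : Set E) m k).Finite) ∧
    ∃ F G H : RatFunc ℚ,
      LatticeCone.ExpandsAtZero F (LatticeCone.series N (C : Set E) m) ∧
      LatticeCone.ExpandsAtZero G (LatticeCone.series N (interior (C : Set E)) m) ∧
      LatticeCone.ExpandsAtInfinity H
        (LatticeCone.seriesInv N (interior (C : Set E)) (-m)) ∧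
      F = (-1) ^ d * H ∧
      Tendsto (fun t : ℝ => (1 - t) ^ d * LatticeCone.value F t) (𝓝[≠] 1)
        (𝓝 (LatticeCone.integralVolume N μ (LatticeCone.truncation C m))) ∧
      Tendsto (fun t : ℝ => (t - 1) ^ d * LatticeCone.value H t) (𝓝[≠] 1)
        (𝓝 (LatticeCone.integralVolume N μ (LatticeCone.truncation C m))) := by
  have hint : ∀ n ∈ N, ∃ k : ℤ, m n = k := hm.1
  have hnat : ∀ n ∈ C, n ∈ N → ∃ k : ℕ, m n = (k : ℝ) := by
    intro n hn hnN
    obtain ⟨k, hk⟩ := hint n hnN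
    have h0 : 0 ≤ m n := by
      by_cases hn0 : n = 0
      · simp [hn0]
      · exact (pos_of_isCompact_truncation hcompact hn hn0).le
    rw [hk] at h0
    exact ⟨k.toNat, by rw [hk]; exact_mod_cast (Int.toNat_of_nonneg (by exact_mod_cast h0)).symm⟩
  have hfin : ∀ k : ℤ, (level N (C : Set E) m k).Finite := finite_level hcompact
  refine ⟨hnat, hfin, ?_⟩
  obtain ⟨S, hSN, hS0, hCS⟩ := hC.exists_nonzero_generators
  set v : S → E := fun s => s with hv
  have hCv : C = PointedCone.hull ℝ (Set.range v) := by rw [hCS]; simp [hv]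
  have hCmem (y : E) : y ∈ C ↔ (representations v y).Nonempty := by
    rw [hCv, mem_hull_range_iff]
  have hvC (s : S) : v s ∈ C := hCS ▸ Submodule.subset_span s.2
  have hvN (s : S) : v s ∈ N := hSN s.2
  have hvpos (s : S) : 0 < m (v s) :=
    pos_of_isCompact_truncation hcompact (hvC s) fun h => hS0 (h ▸ s.2)
  have hspan : Submodule.span ℝ (Set.range v) = ⊤ :=
    span_range_eq_top_of_span_hull v (by rw [← hCv]; exact hdim)
  choose ht hht using fun s => hnat (v s) (hvC s) (hvN s)
  obtain ⟨T, hT⟩ := exists_generic_triangulation hvpos hspan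
  obtain ⟨q, hqint, hq⟩ : ∃ q ∈ interior (C : Set E), IsGeneric v q := by
    by_contra! hcon
    have h1 := isOpen_interior.measure_pos μ (interior_nonempty_of_span_eq_top hdim)
    exact h1.ne' (measure_mono_null hcon (measure_not_isGeneric μ))
  have hq' : IsGeneric v (-q) := fun B i hi h0 => hq B i hi (by simpa using h0)
  set J : ∀ B : BasisIndex v, Set B.1 := fun B => {i | 0 < B.coord q i} with hJ
  -- The coordinates of `q` are nonzero, so reversing `q` exchanges kept and removed facets; this
  -- matches the two decompositions termwise.
  have hJc (B : BasisIndex v) : {i : B.1 | 0 < B.coord (-q) i} = (J B)ᶜ := by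
    ext i
    have := hq B i i.2
    simp only [map_neg, Pi.neg_apply, Left.neg_pos_iff, hJ, Set.mem_ofPred_eq, Set.mem_compl_iff,
      not_lt]
    exact ⟨le_of_lt, fun h => lt_of_le_of_ne h this⟩
  have hdecC := halfOpen_decomposition hCmem hT hq
    (eventually_add_smul_mem_iff (isClosed_of_isCompact_truncation hcompact)
      (interior_subset hqint))
  have hdecI := halfOpen_decomposition hCmem hT hq' (eventually_add_smul_neg_mem_iff hqint)
  simp only [hJc] at hdecI
  set h : ∀ B : BasisIndex v, B.1 → ℕ := fun B i => ht i with hh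
  have hb (B : BasisIndex v) (i : B.1) : B.basis i ∈ N := by rw [B.basis_apply]; exact hvN i
  have hmb (B : BasisIndex v) (i : B.1) : m (B.basis i) = h B i := by rw [B.basis_apply, hht]
  have hpos (B : BasisIndex v) (i : B.1) : 0 < h B i := by
    have := hvpos i
    rw [hht] at this
    exact_mod_cast this
  have hcard (B : BasisIndex v) : Fintype.card B.1 = d := by
    rw [← hd, Module.finrank_eq_card_basis B.basis]
  have hcone (B : BasisIndex v) (K : Set B.1) : halfOpenCone B.basis K ⊆ (C : Set E) := by
    intro x hx
    refine (hCmem x).2 ⟨B.coord x, fun i => ?_, B.sum_coord_smul x⟩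
    by_cases hi : i ∈ B.1
    · have := halfOpenCone_coord_nonneg hx ⟨i, hi⟩
      rwa [← B.coord_coe] at this
    · rw [B.coord_of_notMem x hi]
  have hfin' (B : BasisIndex v) (K : Set B.1) (k : ℤ) :
      (level N (halfOpenCone B.basis K) m k).Finite := (hfin k).subset (level_mono (hcone B K) k)
  set F : RatFunc ℚ := ∑ B ∈ T, coneFunction N B.basis (J B) m (h B) with hF
  set G : RatFunc ℚ := ∑ B ∈ T, coneFunction N B.basis (J B)ᶜ m (h B) with hG
  have hFexp : ExpandsAtZero F (series N (C : Set E) m) := by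
    rw [series_eq_sum T (fun B => halfOpenCone B.basis (J B)) (fun x => (hdecC x).1)
      (fun x => (hdecC x).2) hfin]
    exact expandsAtZero_sum _ _ _ fun B _ =>
      expandsAtZero_coneFunction (hb B) (hmb B) (hpos B) (hfin' B _)
  have hGexp : ExpandsAtZero G (series N (interior (C : Set E)) m) := by
    rw [series_eq_sum T (fun B => halfOpenCone B.basis (J B)ᶜ) (fun x => (hdecI x).1)
      (fun x => (hdecI x).2) fun k => (hfin k).subset (level_mono interior_subset k)]
    exact expandsAtZero_sum _ _ _ fun B _ =>
      expandsAtZero_coneFunction (hb B) (hmb B) (hpos B) (hfin' B _)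
  have hinv : seriesInv N (interior (C : Set E)) (-m) = series N (interior (C : Set E)) m := by
    ext k
    rw [seriesInv, series, PowerSeries.coeff_mk, PowerSeries.coeff_mk]
    congr 2
    ext x
    simp [level]
  have hval (t : ℝ) (ht0 : 0 < t) (ht1 : t ≠ 1) :=
    value_sum_coneFunction_and_denom T N m (fun B : BasisIndex v => B.basis) J h hpos ht0 ht1
  have hpos1 : ∀ᶠ t : ℝ in 𝓝[≠] 1, 0 < t := nhdsWithin_le_nhds (lt_mem_nhds one_pos)
  have hvol : integralVolume N μ (truncation C m)
      = ∑ B ∈ T, (((slabPolynomial N B.basis (J B) m (h B)).eval 1 : ℚ) : ℝ)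
        / ∏ i, (h B i : ℝ) := by
    rw [integralVolume, measureReal_truncation_eq_sum μ hCmem hT hcompact, Finset.sum_div,
      Finset.mul_sum]
    refine Finset.sum_congr rfl fun B _ => ?_
    -- A primitive `m` is nonzero, which rules out dimension `0`.
    have hne : Nonempty B.1 := by
      rw [← Fintype.card_pos_iff, hcard, ← hd, Module.finrank_pos_iff]
      by_contra hsub
      rw [not_nontrivial_iff_subsingleton] at hsub
      exact hm.ne_zero (LinearMap.ext fun x => by rw [Subsingleton.elim x 0, map_zero, map_zero])
    have h1 := measureReal_truncated_cone μ B.basis (hmb B) (hpos B)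
    rw [hcard B, ← hd, measureReal_fundamentalDomain_eq_relIndex_mul_covolume μ (hb B)] at h1
    rw [eval_one_slabPolynomial (hb B) (hmb B) hint (hfin' B _), ← mul_div_assoc, h1]
    have := ZLattice.covolume_ne_zero N μ
    push_cast
    field_simp
  have hlim : Tendsto (fun t : ℝ => (1 - t) ^ d * value F t) (𝓝[≠] 1)
      (𝓝 (integralVolume N μ (truncation C m))) := by
    rw [hvol]
    refine (tendsto_finsetSum T fun B _ =>
      tendsto_value_div_cyclicDenom (hpos B) (slabPolynomial N B.basis (J B) m (h B))).congr' ?_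
    -- For `t > 0` the only possible pole is `t = 1`; negative `t` are avoided because `-1` can be a
    -- root of a denominator.
    filter_upwards [hpos1, self_mem_nhdsWithin] with t ht0 ht1
    rw [(hval t ht0 ht1).1, Finset.mul_sum]
    exact Finset.sum_congr rfl fun B _ => by rw [hcard]
  -- With `H = (-1) ^ d F` the functional equation is immediate; the content is that inverting `t`
  -- in `H` gives `G`.
  refine ⟨F, G, (-1) ^ d * F, hFexp, hGexp, ?_, ?_, hlim, hlim.congr' ?_⟩
  · rw [ExpandsAtInfinity, hinv, hF, eval_inv_X_sum_coneFunction hcard T _ J h hb hmb hpos]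
    exact hGexp
  · rw [← mul_assoc, ← mul_pow]
    simp
  · filter_upwards [hpos1, self_mem_nhdsWithin] with t ht0 ht1
    rw [value_neg_one_pow_mul d (hval t ht0 ht1).2, ← mul_assoc, ← mul_pow]
    congr 2
    ring
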